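/- Let $\mathcal A$ be a finite set, $(f_\rho)_{\rho\in\Theta}$ a family of functions $f_\rho:\mathcal A\to\mathbb R$ and $\theta$ a random parameter such that $(f_\theta(a))_{a\in\mathcal A}$ is multivariate Gaussian (with arbitrary mean, possibly degenerate) with $\mathrm{Var}(f_\theta(a))\le 1$ for every $a\in\mathcal A$. In each period $t$ a (possibly random) nonempty set $\mathcal A_t\subseteq\mathcal A$ is presented, an action $A_t\in\mathcal A_t$ is selected, and a reward $R_t$ is observed. Let $H_t=(\mathcal A_1,A_1,R_1,\dots,\mathcal A_{t-1},A_{t-1},R_{t-1},\mathcal A_t)$. Assume that $\mathcal A_t$ is conditionally independent of $\theta$ given $(\mathcal A_s,A_s,R_s)_{s<t}$ (for instance $\mathcal A_t=\mathcal A$), and that the noise variables $R_t-f_\theta(A_t)$, $t\ge1$, are i.i.d. $N(0,\sigma^2)$ with $\sigma>0$, each $R_t-f_\theta(A_t)$ being independent of $(H_t,\theta,A_t)$. Actions are selected by posterior sampling $\pi^{\mathrm{PS}}$: given $(H_t,\theta)$, the action $A_t$ has the law $\mathbb P(A_t^*\in\cdot\mid H_t)$, where $A_t^*$ is a random variable with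 $A_t^*\in\arg\max_{a\in\mathcal A_t}f_\theta(a)$ almost surely (ties broken in any measurable way). For $a_1,\dots,a_T\in\mathcal A$, the information gain of $(a_1,\dots,a_T)$ is the mutual information (in nats) between $(f_\theta(a))_{a\in\mathcal A}$ and $(f_\theta(a_i)+\varepsilon_i)_{i\le T}$, where the $\varepsilon_i$ are i.i.d. $N(0,\sigma^2)$ and independent of $\theta$; it is the prior entropy of $(f_\theta(a))_{a\in\mathcal A}$ minus its posterior entropy. Let $\gamma_T$ be the maximum of the information gain over all $a_1,\dots,a_T\in\mathcal A$. Then the regrets $\max_{a\in\mathcal A_t}f_\theta(a)-f_\theta(A_t)$ are integrable and, for every $T\in\mathbb N$, $$\mathrm{BayesRegret}(T,\pi^{\mathrm{PS}})=\sum_{t=1}^T\mathbb E\Big[\max_{a\in\mathcal A_t}f_\theta(a)-f_\theta(A_t)\Big]\le 1+2\sqrt{T\,\gamma_T\,\frac{1}{\ln(1+\sigma^{-2})}\,\ln\!\left(\frac{(T^2+1)\,|\mathcal A|}{\sqrt{2\pi}}\right)},$$ where the square root of a negative number is read as $0$ (this matters only for $T=|\mathcal A|=1$). -/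

import Mathlib

open MeasureTheory ProbabilityTheory

noncomputable section

namespace GaussianBandit

/-- The observations of the first `t` periods: for each of them the set of available actions,
the selected action and the observed reward. Periods are numbered from `0`. -/
abbrev Past (𝒜 : Type*) (t : ℕ) : Type _ := Fin t → Set 𝒜 × 𝒜 × ℝ

/-- Histories available when the action of period `t` is chosen: the observations of all earlier
periods, together with the current set of available actions. -/
abbrev Hist (𝒜 : Type*) (t : ℕ) : Type _ := Past 𝒜 t × Set 𝒜

section Model

variable {Ω Θ 𝒜 : Type*}

/-- The random past before period `t`, generated by the available sets `S`, the actions `A` and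
the rewards `R`. -/
def past (S : ℕ → Ω → Set 𝒜) (A : ℕ → Ω → 𝒜) (R : ℕ → Ω → ℝ) (t : ℕ) (ω : Ω) : Past 𝒜 t :=
  fun s => (S s ω, A s ω, R s ω)

/-- The random history at period `t`. -/
def hist (S : ℕ → Ω → Set 𝒜) (A : ℕ → Ω → 𝒜) (R : ℕ → Ω → ℝ) (t : ℕ) (ω : Ω) : Hist 𝒜 t :=
  (past S A R t ω, S t ω)

/-- The regret of period `t`: the largest mean reward among the available actions, minus the mean
reward of the selected action. -/
def periodRegret (f : Θ → 𝒜 → ℝ) (θ : Ω → Θ) (S : ℕ → Ω → Set 𝒜) (A : ℕ → Ω → 𝒜)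
    (t : ℕ) (ω : Ω) : ℝ :=
  (⨆ a : S t ω, f (θ ω) a) - f (θ ω) (A t ω)

variable [MeasurableSpace Ω] [MeasurableSpace Θ] [MeasurableSpace 𝒜]

/-- The Bayesian regret over the first `T` periods. -/
def bayesRegret (μ : Measure Ω) (f : Θ → 𝒜 → ℝ) (θ : Ω → Θ) (S : ℕ → Ω → Set 𝒜)
    (A : ℕ → Ω → 𝒜) (T : ℕ) : ℝ :=
  ∑ t ∈ Finset.range T, ∫ ω, periodRegret f θ S A t ω ∂μ

/-- The interaction of an agent using the policy `π` with a bandit problem. In every period the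
available set is drawn from a law `κ t` that depends on the observed past only, and the action is
then sampled from `π t`, evaluated at the history. Given the past (resp. the history), neither draw
depends on the unknown parameter `θ`. -/
structure IsInteraction (μ : Measure Ω) (f : Θ → 𝒜 → ℝ) (θ : Ω → Θ) (S : ℕ → Ω → Set 𝒜)
    (A : ℕ → Ω → 𝒜) (R : ℕ → Ω → ℝ) (κ : (t : ℕ) → Kernel (Past 𝒜 t) (Set 𝒜))
    (π : (t : ℕ) → Kernel (Hist 𝒜 t) 𝒜) : Prop where
  measurable_reward : ∀ a, Measurable fun ρ => f ρ a
  measurable_param : Measurable θ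
  measurable_set : ∀ t, Measurable (S t)
  measurable_action : ∀ t, Measurable (A t)
  measurable_obs : ∀ t, Measurable (R t)
  set_law : ∀ t, HasCondDistrib (S t) (fun ω => (past S A R t ω, θ ω))
    ((κ t).prodMkRight Θ) μ
  action_law : ∀ t, HasCondDistrib (A t) (fun ω => (hist S A R t ω, θ ω))
    ((π t).prodMkRight Θ) μ

/-- The policy `π` is posterior sampling: `π t`, evaluated at the history, is the conditional law
given the history of a random available action `B` with the largest mean reward (among the
available actions). Ties may be broken in any measurable way. -/
def IsPosteriorSampling (μ : Measure Ω) (f : Θ → 𝒜 → ℝ) (θ : Ω → Θ) (S : ℕ → Ω → Set 𝒜)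
    (A : ℕ → Ω → 𝒜) (R : ℕ → Ω → ℝ) (π : (t : ℕ) → Kernel (Hist 𝒜 t) 𝒜) : Prop :=
  ∀ t, ∃ B : Ω → 𝒜, Measurable B ∧
    (∀ᵐ ω ∂μ, B ω ∈ S t ω ∧ ∀ b ∈ S t ω, f (θ ω) b ≤ f (θ ω) (B ω)) ∧
    HasCondDistrib B (hist S A R t) (π t) μ

/-- The observation noise is i.i.d. `N(0, σ²)`, and the noise of each period is independent of the
history, the parameter and the action of that period. -/
structure IsGaussianNoise (μ : Measure Ω) (f : Θ → 𝒜 → ℝ) (θ : Ω → Θ) (S : ℕ → Ω → Set 𝒜)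
    (A : ℕ → Ω → 𝒜) (R : ℕ → Ω → ℝ) (σ : ℝ) : Prop where
  law : ∀ t, HasLaw (fun ω => R t ω - f (θ ω) (A t ω)) (gaussianReal 0 (σ ^ 2).toNNReal) μ
  iIndep : iIndepFun (fun t ω => R t ω - f (θ ω) (A t ω)) μ
  indep : ∀ t, IndepFun (fun ω => R t ω - f (θ ω) (A t ω))
    (fun ω => (hist S A R t ω, θ ω, A t ω)) μ

end Model

section Information

/-- The mutual information (in nats) of two random variables with joint law `ρ`. -/
def mutualInfo {X Y : Type*} [MeasurableSpace X] [MeasurableSpace Y] (ρ : Measure (X × Y)) : ℝ :=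
  (InformationTheory.klDiv ρ (ρ.fst.prod ρ.snd)).toReal

variable {𝒜 : Type*}

/-- The joint law of a random function `g` with law `P` and of the noisy observations
`g (a i) + ε i`, where the `ε i` are i.i.d. `N(0, σ²)` and independent of `g`. -/
def obsLaw (P : Measure (𝒜 → ℝ)) (σ : ℝ) {T : ℕ} (a : Fin T → 𝒜) :
    Measure ((𝒜 → ℝ) × (Fin T → ℝ)) :=
  (P.prod (Measure.pi fun _ : Fin T => gaussianReal 0 (σ ^ 2).toNNReal)).map
    fun x => (x.1, fun i => x.1 (a i) + x.2 i)

/-- The information gain about `g ∼ P` from playing the actions `a`: the mutual information of `g`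
and the noisy observations, that is, the prior entropy of `g` minus its posterior entropy. In this
form it also makes sense for degenerate Gaussian laws, which have no density. -/
def infoGain (P : Measure (𝒜 → ℝ)) (σ : ℝ) {T : ℕ} (a : Fin T → 𝒜) : ℝ :=
  mutualInfo (obsLaw P σ a)

/-- The maximal information gain `γ_T` over all action sequences of length `T`. -/
def maxInfoGain (P : Measure (𝒜 → ℝ)) (σ : ℝ) (T : ℕ) : ℝ :=
  ⨆ a : Fin T → 𝒜, infoGain P σ a

end Information

end GaussianBandit

end

set_option linter.unusedSectionVars false

/-! Write `Z` for `fluctuation`, the mean reward function minus its posterior mean. Given the past,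
`Z` is centered Gaussian with a law that depends on the past actions only
(`IsInteraction.fluctuation_past`). This is proved by induction on the period: in the linear update
with coefficient `gain`, the noisy observation is independent of the residual
(`IsCenteredGaussian.map_obs_residual`), and the residual is the next fluctuation. The recursion
divides only by a variance plus the positive noise variance, so degenerate priors need no separate
treatment. The available set and the action depend on the parameter through the history alone, so
conditioning on them does not change the law of `Z`.

For `r ≥ 0` let `U` be the posterior mean plus `r` posterior standard deviations `s`. Under
posterior sampling the optimal action `B` and the selected action `A` have the same law given the
history, and `U` is a function of the history, so `U(B)` and `U(A)` have equal expectation. Since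
`Z(A)` has mean zero, the expected regret of a period is `E[Z(B) - r s(B)] + r E[s(A)]`. The first
term is at most the sum over all actions `b` of the expected positive part of `Z(b) - r s(b)`, hence
at most `|𝒜| exp(-r²/2) / √(2π)` by a Gaussian integral (`integral_excess_gaussianReal_le`).

The terms `s(A)` are summed path by path (`sum_postStd_le`). Cauchy–Schwarz reduces the sum to
posterior variances, and a variance in `[0, 1]` is at most `log(1 + s²/σ²) / log(1 + σ⁻²)` by
Bernoulli's inequality. By the chain rule for the Kullback–Leibler divergence, half the sum of the
numerators is the information gain of the realized action sequence (`klDiv_obsLaw`). Posterior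
variances do not depend on the rewards, so the maximum over fixed sequences also controls adaptively
chosen ones. The choice `r = √(2 log K)` with `K = (T² + 1)|𝒜| / √(2π)` makes the first terms add up
to at most `1`. -/

namespace GaussianBandit

/-! ### Gaussian conditioning on one noisy coordinate -/

section Residual

variable {𝒜 : Type*}

/-- The coefficient of the update of coordinate `b` after a noisy observation of coordinate `a` of
a centered random vector with law `ν`, the noise having variance `v`. -/
noncomputable def gain (v : NNReal) (ν : Measure (𝒜 → ℝ)) (a b : 𝒜) : ℝ :=
  cov[fun z => z b, fun z => z a; ν] / (Var[fun z => z a; ν] + v)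

/-- The part of `z` that remains unexplained after coordinate `a` is observed with noise `e`. -/
noncomputable def residual (v : NNReal) (ν : Measure (𝒜 → ℝ)) (a : 𝒜) (z : 𝒜 → ℝ) (e : ℝ) :
    𝒜 → ℝ :=
  fun b => z b - gain v ν a b * (z a + e)

/-- The law of the residual of `z ∼ ν`, observed in coordinate `a` with Gaussian noise. -/
noncomputable def residualStep (v : NNReal) (ν : Measure (𝒜 → ℝ)) (a : 𝒜) : Measure (𝒜 → ℝ) :=
  (ν.prod (gaussianReal 0 v)).map fun x => residual v ν a x.1 x.2

/-- The law of the posterior fluctuation after observing the coordinates `a 0, …, a (t - 1)`. -/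
noncomputable def residualLaw (v : NNReal) (ν : Measure (𝒜 → ℝ)) :
    (t : ℕ) → (Fin t → 𝒜) → Measure (𝒜 → ℝ)
  | 0, _ => ν
  | t + 1, a => residualStep v (residualLaw v ν t (Fin.init a)) (a (Fin.last t))

/-- The posterior variance of coordinate `b` after observing `a 0, …, a (t - 1)`. -/
noncomputable def postVar (v : NNReal) (ν : Measure (𝒜 → ℝ)) (t : ℕ) (a : Fin t → 𝒜) (b : 𝒜) :
    ℝ :=
  Var[fun z => z b; residualLaw v ν t a]

/-- The posterior mean after observing the values `y` in the coordinates `a`. -/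
noncomputable def postMean (v : NNReal) (ν : Measure (𝒜 → ℝ)) (m : 𝒜 → ℝ) :
    (t : ℕ) → (Fin t → 𝒜) → (Fin t → ℝ) → 𝒜 → ℝ
  | 0, _, _ => m
  | t + 1, a, y => fun b =>
      postMean v ν m t (Fin.init a) (Fin.init y) b +
        gain v (residualLaw v ν t (Fin.init a)) (a (Fin.last t)) b *
          (y (Fin.last t) - postMean v ν m t (Fin.init a) (Fin.init y) (a (Fin.last t)))

lemma measurable_residual (v : NNReal) (ν : Measure (𝒜 → ℝ)) (a : 𝒜) :
    Measurable fun x : (𝒜 → ℝ) × ℝ => residual v ν a x.1 x.2 := by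
  unfold residual
  fun_prop

lemma postVar_nonneg (v : NNReal) (ν : Measure (𝒜 → ℝ)) (t : ℕ) (a : Fin t → 𝒜) (b : 𝒜) :
    0 ≤ postVar v ν t a b :=
  variance_nonneg _ _

variable [Fintype 𝒜]

/-- Centered Gaussian laws of random functions. -/
structure IsCenteredGaussian (ν : Measure (𝒜 → ℝ)) : Prop where
  isGaussian : IsGaussian ν
  integral_eq_zero : ∀ b, ∫ z, z b ∂ν = 0

namespace IsCenteredGaussian

variable {ν : Measure (𝒜 → ℝ)}

lemma hasGaussianLaw_id (h : IsCenteredGaussian ν) : HasGaussianLaw (fun z : 𝒜 → ℝ => z) ν := by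
  have := h.isGaussian
  exact IsGaussian.hasGaussianLaw_id

lemma hasGaussianLaw_eval (h : IsCenteredGaussian ν) (b : 𝒜) :
    HasGaussianLaw (fun z : 𝒜 → ℝ => z b) ν :=
  h.hasGaussianLaw_id.map_fun (ContinuousLinearMap.proj b)

lemma map_eval (h : IsCenteredGaussian ν) (b : 𝒜) :
    ν.map (fun z => z b) = gaussianReal 0 (Var[fun z => z b; ν]).toNNReal := by
  rw [(h.hasGaussianLaw_eval b).map_eq_gaussianReal, h.integral_eq_zero]

lemma memLp_eval (h : IsCenteredGaussian ν) (b : 𝒜) : MemLp (fun z : 𝒜 → ℝ => z b) 2 ν :=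
  (h.hasGaussianLaw_eval b).memLp_two

lemma isProbabilityMeasure (h : IsCenteredGaussian ν) : IsProbabilityMeasure ν :=
  h.hasGaussianLaw_id.isProbabilityMeasure

lemma integrable_eval (h : IsCenteredGaussian ν) (b : 𝒜) :
    Integrable (fun z : 𝒜 → ℝ => z b) ν :=
  (h.hasGaussianLaw_eval b).integrable

/-- The observation and the residual are independent, and the observation is Gaussian. -/
lemma map_obs_residual (h : IsCenteredGaussian ν) {v : NNReal} (hv : v ≠ 0) (a : 𝒜) :
    (ν.prod (gaussianReal 0 v)).map (fun x => (x.1 a + x.2, residual v ν a x.1 x.2)) =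
      (gaussianReal 0 (Var[fun z => z a; ν].toNNReal + v)).prod (residualStep v ν a) := by
  have := h.isGaussian
  have := h.isProbabilityMeasure
  set ρ := ν.prod (gaussianReal 0 v)
  have hid : HasGaussianLaw (fun x : (𝒜 → ℝ) × ℝ => x) ρ := IsGaussian.hasGaussianLaw_id
  have hz (b : 𝒜) : HasGaussianLaw (fun x : (𝒜 → ℝ) × ℝ => x.1 b) ρ :=
    hid.map_fun ((ContinuousLinearMap.proj b).comp (ContinuousLinearMap.fst ℝ (𝒜 → ℝ) ℝ))
  have he : HasGaussianLaw (fun x : (𝒜 → ℝ) × ℝ => x.2) ρ := hid.snd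
  let La : (𝒜 → ℝ) × ℝ →L[ℝ] ℝ :=
    (ContinuousLinearMap.proj a).comp (ContinuousLinearMap.fst ℝ (𝒜 → ℝ) ℝ) +
      ContinuousLinearMap.snd ℝ (𝒜 → ℝ) ℝ
  have hobs : HasGaussianLaw (fun x : (𝒜 → ℝ) × ℝ => x.1 a + x.2) ρ := hid.map_fun La
  have hfst (b : 𝒜) : ∫ x, x.1 b ∂ρ = 0 := by
    have := integral_fun_fst (μ := ν) (ν := gaussianReal 0 v) (fun z : 𝒜 → ℝ => z b)
    simpa [h.integral_eq_zero] using this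
  have hcovz (b c : 𝒜) : cov[fun x : (𝒜 → ℝ) × ℝ => x.1 b, fun x => x.1 c; ρ] =
      cov[fun z => z b, fun z => z c; ν] := by
    have := covariance_map_fun (μ := ρ) (Z := Prod.fst) (X := fun z : 𝒜 → ℝ => z b)
      (Y := fun z => z c) (measurable_pi_apply b).aestronglyMeasurable
      (measurable_pi_apply c).aestronglyMeasurable (by fun_prop)
    rw [← this]
    simp [ρ]
  have hcove (b : 𝒜) : cov[fun x : (𝒜 → ℝ) × ℝ => x.1 b, fun x => x.2; ρ] = 0 :=
    covariance_fst_snd_prod (h.memLp_eval b) (memLp_id_gaussianReal 2)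
  have hvar : Var[fun x : (𝒜 → ℝ) × ℝ => x.1 a + x.2; ρ] = Var[fun z => z a; ν] + v := by
    have := variance_add_prod (μ := ν) (ν := gaussianReal 0 v) (h.memLp_eval a)
      (memLp_id_gaussianReal 2)
    simpa using this
  have hpos : 0 < Var[fun z => z a; ν] + (v : ℝ) :=
    add_pos_of_nonneg_of_pos (variance_nonneg _ _) (by positivity)
  -- This identity dictates `gain`: the covariance of the observation with coordinate `b`, divided
  -- by the variance of the observation.
  have hcov (b : 𝒜) : cov[fun x : (𝒜 → ℝ) × ℝ => x.1 a + x.2,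
      fun x => residual v ν a x.1 x.2 b; ρ] = 0 := by
    unfold residual
    rw [covariance_fun_sub_right hobs.memLp_two (hz b).memLp_two
      (hobs.memLp_two.const_mul _), covariance_const_mul_right,
      covariance_self hobs.aemeasurable, hvar, gain, div_mul_cancel₀ _ hpos.ne']
    have := covariance_add_left (hz a).memLp_two he.memLp_two (hz b).memLp_two
    change cov[fun x : (𝒜 → ℝ) × ℝ => x.1 a + x.2, _; ρ] = _ at this
    rw [this, hcovz, covariance_comm (fun x : (𝒜 → ℝ) × ℝ => x.2), hcove,
      covariance_comm (fun z : 𝒜 → ℝ => z a)]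
    ring
  let Lr : (𝒜 → ℝ) × ℝ →L[ℝ] (𝒜 → ℝ) := ContinuousLinearMap.pi fun b =>
    (ContinuousLinearMap.proj b).comp (ContinuousLinearMap.fst ℝ (𝒜 → ℝ) ℝ) - gain v ν a b • La
  -- The scalar observation becomes a family over `Unit`, because the criterion "uncorrelated and
  -- jointly Gaussian implies independent" is applied to two families of coordinates.
  let L : (𝒜 → ℝ) × ℝ →L[ℝ] (Unit → ℝ) × (𝒜 → ℝ) :=
    (ContinuousLinearMap.pi fun _ => La).prod Lr
  have hjoint : HasGaussianLaw (fun x : (𝒜 → ℝ) × ℝ =>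
      ((fun _ : Unit => x.1 a + x.2), fun b => residual v ν a x.1 x.2 b)) ρ := hid.map_fun L
  have hind := hjoint.indepFun_of_covariance_eval
    (X := fun (_ : Unit) (x : (𝒜 → ℝ) × ℝ) => x.1 a + x.2)
    (Y := fun b (x : (𝒜 → ℝ) × ℝ) => residual v ν a x.1 x.2 b) fun _ b => hcov b
  have hind' : IndepFun (fun x : (𝒜 → ℝ) × ℝ => x.1 a + x.2)
      (fun x => residual v ν a x.1 x.2) ρ :=
    hind.comp (φ := fun u : Unit → ℝ => u ()) (ψ := id) (by fun_prop) measurable_id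
  rw [(indepFun_iff_map_prod_eq_prod_map_map (by fun_prop)
    (measurable_residual v ν a).aemeasurable).1 hind', hobs.map_eq_gaussianReal, hvar]
  congr 2
  · rw [integral_add (hz a).integrable he.integrable, hfst]
    have := integral_fun_snd (μ := ν) (ν := gaussianReal 0 v) (fun e : ℝ => e)
    simpa using this
  · rw [Real.toNNReal_add (variance_nonneg _ _) v.coe_nonneg, Real.toNNReal_coe]

protected lemma residualStep (h : IsCenteredGaussian ν) (v : NNReal) (a : 𝒜) :
    IsCenteredGaussian (residualStep v ν a) := by
  have := h.isGaussian
  have := h.isProbabilityMeasure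
  have hid : HasGaussianLaw (fun x : (𝒜 → ℝ) × ℝ => x) (ν.prod (gaussianReal 0 v)) :=
    IsGaussian.hasGaussianLaw_id
  let La : (𝒜 → ℝ) × ℝ →L[ℝ] ℝ :=
    (ContinuousLinearMap.proj a).comp (ContinuousLinearMap.fst ℝ (𝒜 → ℝ) ℝ) +
      ContinuousLinearMap.snd ℝ (𝒜 → ℝ) ℝ
  let Lr : (𝒜 → ℝ) × ℝ →L[ℝ] (𝒜 → ℝ) := ContinuousLinearMap.pi fun b =>
    (ContinuousLinearMap.proj b).comp (ContinuousLinearMap.fst ℝ (𝒜 → ℝ) ℝ) - gain v ν a b • La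
  refine ⟨(hid.map_fun Lr).isGaussian_map, fun b => ?_⟩
  rw [residualStep, integral_map (measurable_residual v ν a).aemeasurable
    (measurable_pi_apply b).aestronglyMeasurable]
  have h1 (b : 𝒜) : ∫ x, x.1 b ∂(ν.prod (gaussianReal 0 v)) = 0 := by
    have := integral_fun_fst (μ := ν) (ν := gaussianReal 0 v) (fun z : 𝒜 → ℝ => z b)
    simpa [h.integral_eq_zero] using this
  have h2 : ∫ x, x.2 ∂(ν.prod (gaussianReal 0 v)) = 0 := by
    have := integral_fun_snd (μ := ν) (ν := gaussianReal 0 v) (fun e : ℝ => e)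
    simpa using this
  have i1 (b : 𝒜) : Integrable (fun x : (𝒜 → ℝ) × ℝ => x.1 b) (ν.prod (gaussianReal 0 v)) :=
    (h.integrable_eval b).comp_fst _
  have i2 : Integrable (fun x : (𝒜 → ℝ) × ℝ => x.2) (ν.prod (gaussianReal 0 v)) :=
    hid.snd.integrable
  simp only [residual]
  rw [integral_sub (i1 b) (Integrable.const_mul (f := fun x => x.1 a + x.2) ((i1 a).add i2) _), integral_const_mul,
    integral_add (i1 a) i2, h1, h1, h2]
  simp

/-- Coordinate `b` is `gain` times the observation plus the residual. The two summands are
independent, so their variances add up to the prior variance. -/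
lemma variance_residualStep_le (h : IsCenteredGaussian ν) {v : NNReal} (hv : v ≠ 0) (a b : 𝒜) :
    Var[fun z => z b; residualStep v ν a] ≤ Var[fun z => z b; ν] := by
  have := h.isProbabilityMeasure
  have hr := h.residualStep v a
  have := hr.isProbabilityMeasure
  set κ := gaussianReal 0 (Var[fun z => z a; ν].toNNReal + v)
  have key : Var[fun x : ℝ × (𝒜 → ℝ) => gain v ν a b * x.1 + x.2 b;
      κ.prod (residualStep v ν a)] = Var[fun z => z b; ν] := by
    rw [← h.map_obs_residual hv, variance_map (by fun_prop)
      (by have := measurable_residual v ν a; fun_prop)]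
    have : ((fun x : ℝ × (𝒜 → ℝ) => gain v ν a b * x.1 + x.2 b) ∘
        fun x : (𝒜 → ℝ) × ℝ => (x.1 a + x.2, residual v ν a x.1 x.2)) =
        (fun z : 𝒜 → ℝ => z b) ∘ Prod.fst := by
      ext x
      simp [residual]
    rw [this, ← variance_map (measurable_pi_apply b).aemeasurable (by fun_prop)]
    simp
  have := variance_add_prod (μ := κ) (ν := residualStep v ν a)
    (X := fun x => gain v ν a b * x) (Y := fun z => z b)
    ((memLp_id_gaussianReal 2).const_mul _) (hr.memLp_eval b)
  rw [← key, this]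
  exact le_add_of_nonneg_left (variance_nonneg _ _)

protected lemma residualLaw (h : IsCenteredGaussian ν) (v : NNReal) :
    ∀ (t : ℕ) (a : Fin t → 𝒜), IsCenteredGaussian (residualLaw v ν t a)
  | 0, _ => h
  | t + 1, a => (h.residualLaw v t (Fin.init a)).residualStep v _

lemma postVar_le (h : IsCenteredGaussian ν) {v : NNReal} (hv : v ≠ 0) :
    ∀ (t : ℕ) (a : Fin t → 𝒜) (b : 𝒜), postVar v ν t a b ≤ Var[fun z => z b; ν]
  | 0, _, _ => le_rfl
  | t + 1, a, b =>
    ((h.residualLaw v t (Fin.init a)).variance_residualStep_le hv _ b).trans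
      (postVar_le h hv t (Fin.init a) b)

end IsCenteredGaussian

end Residual

/-! ### Calculus of conditional distributions -/

section CondDistrib

open scoped ENNReal

variable {Ω 𝓧 𝓨 𝓩 𝓦 : Type*} {mΩ : MeasurableSpace Ω}
  {m𝓧 : MeasurableSpace 𝓧} {m𝓨 : MeasurableSpace 𝓨} {m𝓩 : MeasurableSpace 𝓩}
  {m𝓦 : MeasurableSpace 𝓦}
  {P : Measure Ω} [SFinite P] {X : Ω → 𝓧} {Y : Ω → 𝓨} {W : Ω → 𝓦} {κ : Kernel 𝓧 𝓨}
  [IsSFiniteKernel κ]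

lemma _root_.ProbabilityTheory.HasCondDistrib.lintegral_comp (h : HasCondDistrib Y X κ P)
    {F : 𝓧 × 𝓨 → ℝ≥0∞} (hF : Measurable F) :
    ∫⁻ ω, F (X ω, Y ω) ∂P = ∫⁻ x, ∫⁻ y, F (x, y) ∂κ x ∂(P.map X) := by
  rw [← Measure.lintegral_compProd hF, ← h.map_eq, lintegral_map' hF.aemeasurable h.aemeasurable]

/-- Nonnegative test functions determine the joint law, so conditional laws can be verified by
Tonelli without integrability conditions. -/
lemma _root_.ProbabilityTheory.HasCondDistrib.of_lintegral (hX : AEMeasurable X P)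
    (hY : AEMeasurable Y P)
    (h : ∀ F : 𝓧 × 𝓨 → ℝ≥0∞, Measurable F →
      ∫⁻ ω, F (X ω, Y ω) ∂P = ∫⁻ x, ∫⁻ y, F (x, y) ∂κ x ∂(P.map X)) :
    HasCondDistrib Y X κ P where
  aemeasurable := hX.prodMk hY
  map_eq := by
    refine Measure.ext_of_lintegral _ fun F hF => ?_
    rw [lintegral_map' hF.aemeasurable (hX.prodMk hY), h F hF, Measure.lintegral_compProd hF]

/-- Conditional distribution of a function of the condition and of the variable. -/
lemma _root_.ProbabilityTheory.HasCondDistrib.map_joint (h : HasCondDistrib Y X κ P)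
    {Φ : 𝓧 × 𝓨 → 𝓩} (hΦ : Measurable Φ) {η : Kernel 𝓧 𝓩} [IsSFiniteKernel η]
    (hη : ∀ x, η x = (κ x).map fun y => Φ (x, y)) :
    HasCondDistrib (fun ω => Φ (X ω, Y ω)) X η P := by
  refine .of_lintegral h.aemeasurable_fst (hΦ.comp_aemeasurable h.aemeasurable) fun F hF => ?_
  rw [h.lintegral_comp (F := fun p => F (p.1, Φ p)) (by fun_prop)]
  refine lintegral_congr fun x => ?_
  rw [hη, lintegral_map (by fun_prop) (by fun_prop)]

/-- If `W` depends on `(X, Y)` through `X` only, then knowing `W` does not change the conditional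
distribution of `Y` given `X`. -/
lemma _root_.ProbabilityTheory.HasCondDistrib.prodMk_condIndep (h : HasCondDistrib Y X κ P)
    {η : Kernel 𝓧 𝓦} [IsMarkovKernel η]
    (hW : HasCondDistrib W (fun ω => (X ω, Y ω)) (η.prodMkRight 𝓨) P) :
    HasCondDistrib Y (fun ω => (X ω, W ω)) (κ.prodMkRight 𝓦) P := by
  have hX := h.aemeasurable_fst
  have hWX : HasCondDistrib W X η P := hW.comp_right (f := Prod.fst) (hf := measurable_fst)
  refine .of_lintegral (hX.prodMk hW.aemeasurable_snd) h.aemeasurable_snd fun F hF => ?_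
  have h1 := hW.lintegral_comp (F := fun p => F ((p.1.1, p.2), p.1.2)) (by fun_prop)
  have hm : Measurable fun p : 𝓧 × 𝓨 => ∫⁻ w, F ((p.1, w), p.2) ∂(η.prodMkRight 𝓨 p) :=
    Measurable.lintegral_kernel_prod_right' (κ := η.prodMkRight 𝓨)
      (f := fun q : (𝓧 × 𝓨) × 𝓦 => F ((q.1.1, q.2), q.1.2)) (by fun_prop)
  have hm' : Measurable fun p : 𝓧 × 𝓦 => ∫⁻ y, F (p, y) ∂(κ.prodMkRight 𝓦 p) :=
    Measurable.lintegral_kernel_prod_right' (κ := κ.prodMkRight 𝓦) hF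
  rw [h1, h.map_eq, Measure.lintegral_compProd hm, hWX.map_eq, Measure.lintegral_compProd hm']
  refine lintegral_congr fun x => ?_
  simp only [Kernel.prodMkRight_apply]
  -- For fixed `x`, the laws of `Y` and of `W` form a product, so the order of integration is
  -- irrelevant.
  exact lintegral_lintegral_swap (by fun_prop)

/-- Adjoining an independent variable to a conditional distribution. -/
lemma _root_.ProbabilityTheory.HasCondDistrib.prodMk_indep (h : HasCondDistrib Y X κ P)
    {η : Measure 𝓦} [SFinite η] (hW : HasLaw W η P)
    (hind : IndepFun W (fun ω => (X ω, Y ω)) P) [IsFiniteMeasure P] :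
    HasCondDistrib (fun ω => (Y ω, W ω)) X (κ ×ₖ Kernel.const 𝓧 η) P := by
  have hX := h.aemeasurable_fst
  have hY := h.aemeasurable_snd
  refine .of_lintegral hX (hY.prodMk hW.aemeasurable) fun F hF => ?_
  have hmap := (indepFun_iff_map_prod_eq_prod_map_map (hX.prodMk hY) hW.aemeasurable).1 hind.symm
  have h1 : ∫⁻ ω, F (X ω, (Y ω, W ω)) ∂P =
      ∫⁻ p, F (p.1.1, (p.1.2, p.2)) ∂((P.map fun ω => (X ω, Y ω)).prod η) := by
    rw [← hW.map_eq, ← hmap, lintegral_map' (by fun_prop)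
      ((hX.prodMk hY).prodMk hW.aemeasurable)]
  rw [h1, lintegral_prod _ (by fun_prop), h.map_eq, Measure.lintegral_compProd (by fun_prop)]
  refine lintegral_congr fun x => ?_
  rw [Kernel.prod_apply, Kernel.const_apply, lintegral_prod _ (by fun_prop)]

end CondDistrib

/-! ### The Gaussian update under a conditional law -/

section Update

variable {𝒜 : Type*} [Fintype 𝒜] [MeasurableSpace 𝒜] [MeasurableSingletonClass 𝒜]

/-- `residualLaw` as a kernel. -/
noncomputable def residualKernel (v : NNReal) (ν : Measure (𝒜 → ℝ)) (t : ℕ) :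
    Kernel (Fin t → 𝒜) (𝒜 → ℝ) :=
  ⟨residualLaw v ν t, measurable_of_finite _⟩

/-- The joint law of the innovation and of the residual in the observation of the last coordinate
of a sequence. -/
noncomputable def innovationKernel (v : NNReal) (ν : Measure (𝒜 → ℝ)) (t : ℕ) :
    Kernel (Fin (t + 1) → 𝒜) (ℝ × (𝒜 → ℝ)) :=
  ⟨fun a => (gaussianReal 0 ((postVar v ν t (Fin.init a) (a (Fin.last t))).toNNReal + v)).prod
    (residualLaw v ν (t + 1) a), measurable_of_finite _⟩

lemma measurable_init {β : Type*} [MeasurableSpace β] {t : ℕ} :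
    Measurable fun a : Fin (t + 1) → β => (Fin.init a : Fin t → β) :=
  measurable_pi_lambda _ fun i => measurable_pi_apply i.castSucc

namespace IsCenteredGaussian

variable {ν : Measure (𝒜 → ℝ)}

lemma isMarkovKernel_residualKernel (h : IsCenteredGaussian ν) (v : NNReal) (t : ℕ) :
    IsMarkovKernel (residualKernel v ν t) :=
  ⟨fun a => (h.residualLaw v t a).isProbabilityMeasure⟩

lemma isMarkovKernel_innovationKernel (h : IsCenteredGaussian ν) (v : NNReal) (t : ℕ) :
    IsMarkovKernel (innovationKernel v ν t) :=
  ⟨fun a => by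
    have := (h.residualLaw v (t + 1) a).isProbabilityMeasure
    change IsProbabilityMeasure (Measure.prod _ _)
    infer_instance⟩

variable {Ω 𝓧 : Type*} {mΩ : MeasurableSpace Ω} {m𝓧 : MeasurableSpace 𝓧} {P : Measure Ω}
  [IsProbabilityMeasure P] {X : Ω → 𝓧} {Z : Ω → 𝒜 → ℝ} {ε : Ω → ℝ} {v : NNReal} {t : ℕ}
  {c : 𝓧 → Fin (t + 1) → 𝒜}

/-- The Gaussian update: if, given `X`, the fluctuation `Z` has the law determined by all but the
last coordinate of `c X`, then the innovation and the residual have the law determined by `c X`. -/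
lemma hasCondDistrib_innovation (h : IsCenteredGaussian ν) (hv : v ≠ 0) (hc : Measurable c)
    (hZ : HasCondDistrib Z X
      ((residualKernel v ν t).comap (fun x => Fin.init (c x)) (measurable_init.comp hc)) P)
    (hε : HasLaw ε (gaussianReal 0 v) P) (hind : IndepFun ε (fun ω => (X ω, Z ω)) P) :
    HasCondDistrib (fun ω => (Z ω (c (X ω) (Fin.last t)) + ε ω,
      residual v (residualLaw v ν t (Fin.init (c (X ω)))) (c (X ω) (Fin.last t)) (Z ω) (ε ω)))
      X ((innovationKernel v ν t).comap c hc) P := by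
  have := h.isMarkovKernel_residualKernel v t
  have := h.isMarkovKernel_innovationKernel v t
  let Ψ : (Fin (t + 1) → 𝒜) × ((𝒜 → ℝ) × ℝ) → ℝ × (𝒜 → ℝ) := fun p =>
    (p.2.1 (p.1 (Fin.last t)) + p.2.2,
      residual v (residualLaw v ν t (Fin.init p.1)) (p.1 (Fin.last t)) p.2.1 p.2.2)
  have hΨ : Measurable Ψ := by
    -- There are finitely many action sequences, so joint measurability is checked for each fixed
    -- sequence.
    refine measurable_from_prod_countable_right fun a => ?_
    have := measurable_residual v (residualLaw v ν t (Fin.init a)) (a (Fin.last t))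
    exact (((measurable_pi_apply _).comp measurable_fst).add measurable_snd).prodMk this
  refine (hZ.prodMk_indep hε hind).map_joint
    (Φ := fun p => Ψ (c p.1, p.2)) (by fun_prop) fun x => ?_
  rw [Kernel.comap_apply, Kernel.prod_apply, Kernel.comap_apply, Kernel.const_apply]
  exact ((h.residualLaw v t (Fin.init (c x))).map_obs_residual hv (c x (Fin.last t))).symm

end IsCenteredGaussian

end Update

lemma measurable_snoc {β : Type*} [MeasurableSpace β] {t : ℕ} :
    Measurable fun p : (Fin t → β) × β => (Fin.snoc p.1 p.2 : Fin (t + 1) → β) := by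
  refine measurable_pi_lambda _ fun i => ?_
  induction i using Fin.lastCases with
  | last => simpa using measurable_snd
  | cast i => simpa using! (measurable_pi_apply i).comp measurable_fst

/-! ### Posterior mean and centering of the prior -/

section PostMean

variable {𝒜 : Type*} [Fintype 𝒜] [MeasurableSpace 𝒜] [MeasurableSingletonClass 𝒜]

lemma measurable_postMean (v : NNReal) (ν : Measure (𝒜 → ℝ)) (m : 𝒜 → ℝ) (t : ℕ) :
    Measurable fun p : (Fin t → 𝒜) × (Fin t → ℝ) => postMean v ν m t p.1 p.2 := by
  refine measurable_from_prod_countable_right fun a => ?_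
  change Measurable fun y => postMean v ν m t a y
  induction t with
  | zero => exact measurable_const
  | succ t ih =>
    refine measurable_pi_lambda _ fun b => ?_
    have h (c : 𝒜) : Measurable fun y : Fin (t + 1) → ℝ =>
        postMean v ν m t (Fin.init a) (Fin.init y) c :=
      (measurable_pi_apply c).comp ((ih (Fin.init a)).comp measurable_init)
    exact (h b).add (((measurable_pi_apply (Fin.last t)).sub (h _)).const_mul _)

/-- The mean of a random function with law `P`. -/
noncomputable def mean (P : Measure (𝒜 → ℝ)) (b : 𝒜) : ℝ := ∫ w, w b ∂P

/-- The law of the centered random function. -/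
noncomputable def centeredLaw (P : Measure (𝒜 → ℝ)) : Measure (𝒜 → ℝ) :=
  P.map fun z b => z b - mean P b

lemma isCenteredGaussian_centeredLaw (P : Measure (𝒜 → ℝ)) [IsGaussian P] :
    IsCenteredGaussian (centeredLaw P) := by
  have hm : Measurable fun (z : 𝒜 → ℝ) b => z b - mean P b :=
    measurable_pi_lambda _ fun b => (measurable_pi_apply b).sub_const _
  refine ⟨?_, fun b => ?_⟩
  · rw [centeredLaw]
    have : (fun (z : 𝒜 → ℝ) b => z b - mean P b) = fun z => z - mean P := rfl
    rw [this]
    infer_instance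
  · have hb : HasGaussianLaw (fun z : 𝒜 → ℝ => z b) P :=
      HasGaussianLaw.map_fun (IsGaussian.hasGaussianLaw_id (μ := P)) (ContinuousLinearMap.proj b)
    rw [centeredLaw, integral_map hm.aemeasurable (measurable_pi_apply b).aestronglyMeasurable,
      integral_sub hb.integrable (integrable_const _)]
    simp [mean]

lemma variance_centeredLaw (P : Measure (𝒜 → ℝ)) [IsProbabilityMeasure P] (b : 𝒜) :
    Var[fun z => z b; centeredLaw P] = Var[fun z => z b; P] := by
  have hm : Measurable fun (z : 𝒜 → ℝ) b => z b - mean P b :=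
    measurable_pi_lambda _ fun b => (measurable_pi_apply b).sub_const _
  rw [centeredLaw, variance_map (measurable_pi_apply b).aemeasurable hm.aemeasurable]
  exact variance_sub_const (measurable_pi_apply b).aestronglyMeasurable _

end PostMean

/-! ### Law of the posterior fluctuation along the interaction -/

section History

variable {Ω Θ 𝒜 : Type*}

/-- The actions in a past. -/
def pastActions {t : ℕ} (p : Past 𝒜 t) : Fin t → 𝒜 := fun i => (p i).2.1

/-- The rewards in a past. -/
def pastRewards {t : ℕ} (p : Past 𝒜 t) : Fin t → ℝ := fun i => (p i).2.2

variable [MeasurableSpace Ω] [MeasurableSpace Θ]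
  [Fintype 𝒜] [MeasurableSpace 𝒜] [MeasurableSingletonClass 𝒜]

lemma measurable_pastActions {t : ℕ} : Measurable (pastActions : Past 𝒜 t → Fin t → 𝒜) :=
  measurable_pi_lambda _ fun i => (measurable_pi_apply i).snd.fst

lemma measurable_pastRewards {t : ℕ} : Measurable (pastRewards : Past 𝒜 t → Fin t → ℝ) :=
  measurable_pi_lambda _ fun i => (measurable_pi_apply i).snd.snd

/-- The posterior mean as a function of the past. -/
noncomputable def pastMean (P : Measure (𝒜 → ℝ)) (v : NNReal) {t : ℕ} (p : Past 𝒜 t) : 𝒜 → ℝ :=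
  postMean v (centeredLaw P) (mean P) t (pastActions p) (pastRewards p)

lemma measurable_pastMean (P : Measure (𝒜 → ℝ)) (v : NNReal) {t : ℕ} :
    Measurable (pastMean P v : Past 𝒜 t → 𝒜 → ℝ) :=
  (measurable_postMean v (centeredLaw P) (mean P) t).comp
    (measurable_pastActions.prodMk measurable_pastRewards)

/-- The posterior fluctuation of the mean reward function. -/
noncomputable def fluctuation (P : Measure (𝒜 → ℝ)) (v : NNReal) (f : Θ → 𝒜 → ℝ) (θ : Ω → Θ)
    (S : ℕ → Ω → Set 𝒜) (A : ℕ → Ω → 𝒜) (R : ℕ → Ω → ℝ) (t : ℕ) (ω : Ω) : 𝒜 → ℝ :=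
  fun b => f (θ ω) b - pastMean P v (past S A R t ω) b

/-- The conditional law of the posterior fluctuation given the past. -/
noncomputable def pastKernel (P : Measure (𝒜 → ℝ)) (v : NNReal) (t : ℕ) :
    Kernel (Past 𝒜 t) (𝒜 → ℝ) :=
  (residualKernel v (centeredLaw P) t).comap pastActions measurable_pastActions

instance (P : Measure (𝒜 → ℝ)) [IsGaussian P] (v : NNReal) (t : ℕ) :
    IsMarkovKernel (pastKernel P v t) :=
  have := (isCenteredGaussian_centeredLaw P).isMarkovKernel_residualKernel v t
  inferInstanceAs (IsMarkovKernel ((residualKernel v (centeredLaw P) t).comap _ _))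

variable {μ : Measure Ω} [IsProbabilityMeasure μ] {f : Θ → 𝒜 → ℝ} {θ : Ω → Θ}
  {S : ℕ → Ω → Set 𝒜} {A : ℕ → Ω → 𝒜} {R : ℕ → Ω → ℝ}
  {κ : (t : ℕ) → Kernel (Past 𝒜 t) (Set 𝒜)} [∀ t, IsMarkovKernel (κ t)]
  {π : (t : ℕ) → Kernel (Hist 𝒜 t) 𝒜} [∀ t, IsMarkovKernel (π t)] {P : Measure (𝒜 → ℝ)}
  {v : NNReal} {t : ℕ}

namespace IsInteraction

lemma measurable_past (h : IsInteraction μ f θ S A R κ π) (t : ℕ) :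
    Measurable (past S A R t) :=
  measurable_pi_lambda _ fun i =>
    (h.measurable_set i).prodMk ((h.measurable_action i).prodMk (h.measurable_obs i))

/-- The fluctuation as a function of the past and of the parameter. -/
lemma measurable_fluctuation_fun (h : IsInteraction μ f θ S A R κ π) (P : Measure (𝒜 → ℝ))
    (v : NNReal) (t : ℕ) :
    Measurable fun x : Past 𝒜 t × Θ => fun b => f x.2 b - pastMean P v x.1 b :=
  measurable_pi_lambda _ fun b => ((h.measurable_reward b).comp measurable_snd).sub
    ((measurable_pi_apply b).comp ((measurable_pastMean P v).comp measurable_fst))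

lemma measurable_fluctuation (h : IsInteraction μ f θ S A R κ π) (P : Measure (𝒜 → ℝ))
    (v : NNReal) (t : ℕ) : Measurable (fluctuation P v f θ S A R t) :=
  (h.measurable_fluctuation_fun P v t).comp ((h.measurable_past t).prodMk h.measurable_param)

/-- The available set has a law given (past, parameter) that depends on the past alone. The pair
(past, fluctuation) is a function of (past, parameter), so the set is conditionally independent of
the fluctuation. -/
lemma fluctuation_hist [IsGaussian P] (h : IsInteraction μ f θ S A R κ π)
    (hZ : HasCondDistrib (fluctuation P v f θ S A R t) (past S A R t) (pastKernel P v t) μ) :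
    HasCondDistrib (fluctuation P v f θ S A R t) (hist S A R t)
      ((pastKernel P v t).prodMkRight (Set 𝒜)) μ :=
  hZ.prodMk_condIndep (η := κ t) ((h.set_law t).comp_right
    (f := fun x : Past 𝒜 t × Θ => (x.1, fun b => f x.2 b - pastMean P v x.1 b))
    (hf := measurable_fst.prodMk (h.measurable_fluctuation_fun P v t))
    (κ := (κ t).prodMkRight (𝒜 → ℝ)))

/-- The same argument, with the policy in place of the law of the available set. Only the fact that
the action is drawn from the history is used, not posterior sampling. -/
lemma fluctuation_action [IsGaussian P] (h : IsInteraction μ f θ S A R κ π)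
    (hZ : HasCondDistrib (fluctuation P v f θ S A R t) (past S A R t) (pastKernel P v t) μ) :
    HasCondDistrib (fluctuation P v f θ S A R t) (fun ω => (hist S A R t ω, A t ω))
      (((pastKernel P v t).prodMkRight (Set 𝒜)).prodMkRight 𝒜) μ :=
  (h.fluctuation_hist hZ).prodMk_condIndep (η := π t) ((h.action_law t).comp_right
    (f := fun x : Hist 𝒜 t × Θ => (x.1, fun b => f x.2 b - pastMean P v x.1.1 b))
    (hf := measurable_fst.prodMk ((h.measurable_fluctuation_fun P v t).comp
      (measurable_fst.fst.prodMk measurable_snd)))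
    (κ := (π t).prodMkRight (𝒜 → ℝ)))

/-- Inductive step: the update yields an innovation independent of the residual given history and
action. The innovation is then moved into the condition, and together with history and action it
determines the new past. -/
lemma fluctuation_past_succ [IsGaussian P] (h : IsInteraction μ f θ S A R κ π) {σ : ℝ}
    (hσ : 0 < σ) (hn : IsGaussianNoise μ f θ S A R σ)
    (hZ : HasCondDistrib (fluctuation P (σ ^ 2).toNNReal f θ S A R t) (past S A R t)
      (pastKernel P (σ ^ 2).toNNReal t) μ) :
    HasCondDistrib (fluctuation P (σ ^ 2).toNNReal f θ S A R (t + 1)) (past S A R (t + 1))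
      (pastKernel P (σ ^ 2).toNNReal (t + 1)) μ := by
  set v := (σ ^ 2).toNNReal with hv_def
  have hv : v ≠ 0 := by simpa [hv_def] using hσ.ne'
  have hG := isCenteredGaussian_centeredLaw P
  have := hG.isMarkovKernel_residualKernel v (t + 1)
  have := hG.isMarkovKernel_innovationKernel v t
  let c : Hist 𝒜 t × 𝒜 → Fin (t + 1) → 𝒜 := fun x => Fin.snoc (pastActions x.1.1) x.2
  have hc : Measurable c :=
    measurable_snoc.comp ((measurable_pastActions.comp measurable_fst.fst).prodMk measurable_snd)
  let X : Ω → Hist 𝒜 t × 𝒜 := fun ω => (hist S A R t ω, A t ω)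
  let Z := fluctuation P v f θ S A R t
  have hk : ((pastKernel P v t).prodMkRight (Set 𝒜)).prodMkRight 𝒜 =
      (residualKernel v (centeredLaw P) t).comap (fun x => Fin.init (c x))
        (measurable_init.comp hc) := by
    ext1 x
    simp [pastKernel, c, Kernel.comap_apply]
  have hZX : HasCondDistrib Z X ((residualKernel v (centeredLaw P) t).comap
      (fun x => Fin.init (c x)) (measurable_init.comp hc)) μ := hk ▸ h.fluctuation_action hZ
  have hind : IndepFun (fun ω => R t ω - f (θ ω) (A t ω)) (fun ω => (X ω, Z ω)) μ := by
    have hm : Measurable fun x : Hist 𝒜 t × Θ × 𝒜 =>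
        (((x.1, x.2.2) : Hist 𝒜 t × 𝒜), fun b => f x.2.1 b - pastMean P v x.1.1 b) :=
      (measurable_fst.prodMk measurable_snd.snd).prodMk
        ((h.measurable_fluctuation_fun P v t).comp
          (measurable_fst.fst.prodMk measurable_snd.fst))
    exact (hn.indep t).comp measurable_id hm
  have hinn := hG.hasCondDistrib_innovation hv hc hZX (hn.law t) hind
  set V : Ω → ℝ := fun ω => R t ω - pastMean P v (past S A R t ω) (A t ω) with hV
  -- Noise plus fluctuation at the played action is the reward minus its prediction, and the
  -- recursion in `postMean` is the one that turns the residual into the next fluctuation.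
  have hVZ : (fun ω => (Z ω (c (X ω) (Fin.last t)) + (R t ω - f (θ ω) (A t ω)),
      residual v (residualLaw v (centeredLaw P) t (Fin.init (c (X ω)))) (c (X ω) (Fin.last t))
        (Z ω) (R t ω - f (θ ω) (A t ω)))) =
      fun ω => (V ω, fluctuation P v f θ S A R (t + 1) ω) := by
    funext ω
    have e1 : c (X ω) (Fin.last t) = A t ω := by simp [c, X]
    have e2 : Fin.init (c (X ω)) = pastActions (past S A R t ω) := by simp [c, X, hist]
    rw [e1, e2]
    refine Prod.ext ?_ ?_
    · simp only [hV, Z, fluctuation]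
      ring
    · funext b
      change f (θ ω) b - pastMean P v (past S A R t ω) b -
        gain v (residualLaw v (centeredLaw P) t (pastActions (past S A R t ω))) (A t ω) b *
          (f (θ ω) (A t ω) - pastMean P v (past S A R t ω) (A t ω) +
            (R t ω - f (θ ω) (A t ω))) =
        f (θ ω) b - (pastMean P v (past S A R t ω) b +
          gain v (residualLaw v (centeredLaw P) t (pastActions (past S A R t ω))) (A t ω) b *
          (R t ω - pastMean P v (past S A R t ω) (A t ω)))
      ring
  rw [hVZ] at hinn
  let η : Kernel ((Hist 𝒜 t × 𝒜) × ℝ) (𝒜 → ℝ) :=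
    (residualKernel v (centeredLaw P) (t + 1)).comap (fun x => c x.1) (hc.comp measurable_fst)
  -- A product law is a composition with a second kernel that ignores the innovation; in this form
  -- `of_compProd` can condition on the innovation.
  have hsplit : (innovationKernel v (centeredLaw P) t).comap c hc =
      ((innovationKernel v (centeredLaw P) t).comap c hc).fst ⊗ₖ η := by
    ext1 x
    rw [Kernel.compProd_apply_eq_compProd_sectR]
    have := (hG.residualLaw v (t + 1) (c x)).isProbabilityMeasure
    have e : Kernel.sectR η x = Kernel.const ℝ (residualLaw v (centeredLaw P) (t + 1) (c x)) := by
      ext1 y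
      rfl
    rw [e, Measure.compProd_const, Kernel.fst_apply]
    change Measure.prod _ _ = (Measure.map Prod.fst (Measure.prod _ _)).prod _
    rw [Measure.map_fst_prod]
    simp
  rw [hsplit] at hinn
  have hlast := hinn.of_compProd
  -- The reward is recovered by adding the posterior mean at the played action to the innovation.
  let F : (Hist 𝒜 t × 𝒜) × ℝ → Past 𝒜 (t + 1) := fun x =>
    Fin.snoc x.1.1.1 (x.1.1.2, x.1.2, x.2 + pastMean P v x.1.1.1 x.1.2)
  have hF : Measurable F := by
    refine measurable_snoc.comp (measurable_fst.fst.fst.prodMk (measurable_fst.fst.snd.prodMk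
      (measurable_fst.snd.prodMk (measurable_snd.add ?_))))
    have : Measurable fun p : (𝒜 → ℝ) × 𝒜 => p.1 p.2 :=
      measurable_from_prod_countable_left fun a => measurable_pi_apply a
    exact this.comp (((measurable_pastMean P v).comp measurable_fst.fst.fst).prodMk
      measurable_fst.snd)
  have hη : η = (pastKernel P v (t + 1)).comap F hF := by
    ext1 x
    simp only [η, pastKernel, Kernel.comap_apply]
    congr 1
    funext i
    induction i using Fin.lastCases with
    | last => simp [c, F, pastActions]
    | cast i => simp [c, F, pastActions]
  rw [hη] at hlast
  have hfin := hlast.comp_right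
  convert hfin using 1
  funext ω i
  induction i using Fin.lastCases with
  | last => simp [F, X, V, hist, past]
  | cast i => simp [F, X, hist, past]

lemma fluctuation_past_zero [IsGaussian P] (h : IsInteraction μ f θ S A R κ π)
    (hP : HasLaw (fun ω a => f (θ ω) a) P μ) :
    HasCondDistrib (fluctuation P v f θ S A R 0) (past S A R 0) (pastKernel P v 0) μ := by
  refine .of_lintegral (h.measurable_past 0).aemeasurable
    (h.measurable_fluctuation P v 0).aemeasurable fun F hF => ?_
  have hpast : past S A R 0 = fun _ => Fin.elim0 := by
    funext ω i
    exact i.elim0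
  have hm : Measurable fun (z : 𝒜 → ℝ) b => z b - mean P b :=
    measurable_pi_lambda _ fun b => (measurable_pi_apply b).sub_const _
  -- The empty past is deterministic, so its law is a Dirac mass and the condition carries no
  -- information.
  rw [hpast, Measure.map_const, measure_univ, one_smul, lintegral_dirac' _
    (Measurable.lintegral_kernel_prod_right' hF)]
  change _ = ∫⁻ y, F (Fin.elim0, y) ∂(centeredLaw P)
  have hFm : Measurable fun z : 𝒜 → ℝ => F (Fin.elim0, fun b => z b - mean P b) :=
    hF.comp (measurable_const.prodMk hm)
  have e := lintegral_map' hFm.aemeasurable hP.aemeasurable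
  rw [hP.map_eq] at e
  rw [centeredLaw, lintegral_map (by fun_prop) hm]
  exact e.symm

/-- Given the past, the fluctuation has the Gaussian law determined by the past actions. -/
theorem fluctuation_past [IsGaussian P] (h : IsInteraction μ f θ S A R κ π)
    (hP : HasLaw (fun ω a => f (θ ω) a) P μ) {σ : ℝ} (hσ : 0 < σ)
    (hn : IsGaussianNoise μ f θ S A R σ) (t : ℕ) :
    HasCondDistrib (fluctuation P (σ ^ 2).toNNReal f θ S A R t) (past S A R t)
      (pastKernel P (σ ^ 2).toNNReal t) μ := by
  induction t with
  | zero => exact h.fluctuation_past_zero hP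
  | succ t ih => exact h.fluctuation_past_succ hσ hn ih

end IsInteraction

end History

open scoped ENNReal
open InformationTheory

/-! ### Divergence between Gaussian kernels -/

section GaussianKernel

variable {𝓧 𝓨 : Type*} {m𝓧 : MeasurableSpace 𝓧} {m𝓨 : MeasurableSpace 𝓨}

/-- The kernel of Gaussian laws with mean `m x` and variance `v`. -/
noncomputable def gaussianKernel (m : 𝓧 → ℝ) (hm : Measurable m) (v : NNReal) : Kernel 𝓧 ℝ :=
  ⟨fun x => gaussianReal (m x) v, measurable_gaussianReal.comp (hm.prodMk measurable_const)⟩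

instance (m : 𝓧 → ℝ) (hm : Measurable m) (v : NNReal) : IsMarkovKernel (gaussianKernel m hm v) :=
  ⟨fun _ => inferInstanceAs (IsProbabilityMeasure (gaussianReal _ _))⟩

lemma compProd_gaussianKernel (ρ : Measure 𝓧) [SFinite ρ] (m : 𝓧 → ℝ) (hm : Measurable m)
    (v : NNReal) :
    ρ ⊗ₘ gaussianKernel m hm v =
      (ρ.prod (gaussianReal 0 v)).map fun x => (x.1, m x.1 + x.2) := by
  refine Measure.ext_of_lintegral _ fun F hF => ?_
  rw [Measure.lintegral_compProd hF, lintegral_map hF (by fun_prop), lintegral_prod _ (by fun_prop)]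
  refine lintegral_congr fun x => ?_
  change ∫⁻ r, F (x, r) ∂gaussianReal (m x) v = _
  have := gaussianReal_map_const_add (μ := 0) (v := v) (m x)
  rw [zero_add] at this
  rw [← this, lintegral_map (by fun_prop) (by fun_prop)]

lemma log_gaussianPDFReal (m : ℝ) {v : NNReal} (hv : v ≠ 0) (x : ℝ) :
    Real.log (gaussianPDFReal m v x) =
      -(Real.log (2 * Real.pi * v) / 2) - (x - m) ^ 2 / (2 * v) := by
  have : (0 : ℝ) < v := by positivity
  rw [gaussianPDFReal, Real.log_mul (by positivity) (by positivity), Real.log_inv, Real.log_exp,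
    Real.log_sqrt (by positivity)]
  ring

lemma gaussianReal_eq_withDensity (m₁ m₂ : ℝ) {v w : NNReal} (hv : v ≠ 0) (hw : w ≠ 0) :
    gaussianReal m₁ v = (gaussianReal m₂ w).withDensity
      fun r => ENNReal.ofReal (gaussianPDFReal m₁ v r / gaussianPDFReal m₂ w r) := by
  rw [gaussianReal_of_var_ne_zero _ hv, gaussianReal_of_var_ne_zero _ hw,
    ← withDensity_mul _ (by fun_prop) (by fun_prop)]
  congr 1
  funext r
  have := gaussianPDFReal_pos m₂ w r hw
  rw [Pi.mul_apply, gaussianPDF, gaussianPDF, ← ENNReal.ofReal_mul this.le,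
    mul_div_cancel₀ _ this.ne']

lemma integral_sq_of_hasLaw {Ω : Type*} {mΩ : MeasurableSpace Ω} {ρ : Measure Ω} {X : Ω → ℝ}
    {v : NNReal} (h : HasLaw X (gaussianReal 0 v) ρ) :
    Integrable (fun ω => X ω ^ 2) ρ ∧ ∫ ω, X ω ^ 2 ∂ρ = v := by
  have h2 : MemLp (fun x : ℝ => x) 2 (gaussianReal 0 v) := memLp_id_gaussianReal 2
  have hi : Integrable (fun x : ℝ => x ^ 2) (ρ.map X) := h.map_eq ▸ h2.integrable_sq
  refine ⟨hi.comp_aemeasurable h.aemeasurable, ?_⟩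
  have e := integral_map (μ := ρ) (f := fun x : ℝ => x ^ 2) h.aemeasurable (by fun_prop)
  have hvar := variance_fun_id_gaussianReal (μ := 0) (v := v)
  rw [variance_of_integral_eq_zero (by fun_prop) integral_id_gaussianReal] at hvar
  rw [← e, h.map_eq, hvar]

/-- The divergence of two Gaussian kernels, averaged over a law of the condition under which the
prediction error of the second one has the predicted variance. -/
lemma klDiv_gaussianKernel (ρ : Measure 𝓧) [IsProbabilityMeasure ρ] {m₁ m₂ : 𝓧 → ℝ}
    (hm₁ : Measurable m₁) (hm₂ : Measurable m₂) {v w : NNReal} (hv : v ≠ 0) (hw : w ≠ 0)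
    (hlaw : HasLaw (fun p : 𝓧 × ℝ => p.2 - m₂ p.1) (gaussianReal 0 w)
      (ρ ⊗ₘ gaussianKernel m₁ hm₁ v)) :
    klDiv (ρ ⊗ₘ gaussianKernel m₁ hm₁ v) (ρ ⊗ₘ gaussianKernel m₂ hm₂ w) ≠ ∞ ∧
      (klDiv (ρ ⊗ₘ gaussianKernel m₁ hm₁ v) (ρ ⊗ₘ gaussianKernel m₂ hm₂ w)).toReal =
        1 / 2 * Real.log (w / v) := by
  set κ := gaussianKernel m₁ hm₁ v
  set η := gaussianKernel m₂ hm₂ w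
  let D : 𝓧 × ℝ → ℝ≥0∞ := fun p =>
    ENNReal.ofReal (gaussianPDFReal (m₁ p.1) v p.2 / gaussianPDFReal (m₂ p.1) w p.2)
  have hD : Measurable D := by
    have h := measurable_uncurry_gaussianPDFReal
    refine ENNReal.measurable_ofReal.comp (Measurable.div ?_ ?_)
    · exact h.comp ((hm₁.comp measurable_fst).prodMk (measurable_const.prodMk measurable_snd))
    · exact h.comp ((hm₂.comp measurable_fst).prodMk (measurable_const.prodMk measurable_snd))
  -- The two joint laws share the marginal `ρ`, so the ratio of the conditional densities is a joint
  -- density.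
  have hκη : ρ ⊗ₘ κ = (ρ ⊗ₘ η).withDensity D := by
    refine Measure.ext_of_lintegral _ fun F hF => ?_
    rw [lintegral_withDensity_eq_lintegral_mul _ hD hF, Measure.lintegral_compProd hF,
      Measure.lintegral_compProd (hD.mul hF)]
    refine lintegral_congr fun x => ?_
    change ∫⁻ r, F (x, r) ∂gaussianReal (m₁ x) v =
      ∫⁻ r, (D * F) (x, r) ∂gaussianReal (m₂ x) w
    rw [gaussianReal_eq_withDensity (m₁ x) (m₂ x) hv hw]
    exact lintegral_withDensity_eq_lintegral_mul _ (hD.comp measurable_prodMk_left)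
      (hF.comp measurable_prodMk_left)
  have hac : ρ ⊗ₘ κ ≪ ρ ⊗ₘ η := hκη ▸ withDensity_absolutelyContinuous _ _
  have hlaw₁ : HasLaw (fun p : 𝓧 × ℝ => p.2 - m₁ p.1) (gaussianReal 0 v) (ρ ⊗ₘ κ) := by
    refine ⟨by fun_prop, ?_⟩
    rw [compProd_gaussianKernel, Measure.map_map (by fun_prop) (by fun_prop)]
    have : ((fun p : 𝓧 × ℝ => p.2 - m₁ p.1) ∘ fun x : 𝓧 × ℝ => (x.1, m₁ x.1 + x.2)) =
        Prod.snd := by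
      ext x
      simp
    rw [this, Measure.map_snd_prod]
    simp
  obtain ⟨i₁, e₁⟩ := integral_sq_of_hasLaw hlaw₁
  obtain ⟨i₂, e₂⟩ := integral_sq_of_hasLaw hlaw
  have hllr : llr (ρ ⊗ₘ κ) (ρ ⊗ₘ η) =ᵐ[ρ ⊗ₘ κ] fun p =>
      1 / 2 * Real.log (w / v) - (p.2 - m₁ p.1) ^ 2 / (2 * v) + (p.2 - m₂ p.1) ^ 2 / (2 * w) := by
    have hr := hac.ae_le (hκη ▸ Measure.rnDeriv_withDensity (ρ ⊗ₘ η) hD)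
    filter_upwards [hr] with p hp
    have h₁ := gaussianPDFReal_pos (m₁ p.1) v p.2 hv
    have h₂ := gaussianPDFReal_pos (m₂ p.1) w p.2 hw
    rw [llr, hp, ENNReal.toReal_ofReal (by positivity), Real.log_div h₁.ne' h₂.ne',
      log_gaussianPDFReal _ hv, log_gaussianPDFReal _ hw,
      Real.log_mul (x := 2 * Real.pi) (y := v) (by positivity) (by positivity),
      Real.log_mul (x := 2 * Real.pi) (y := w) (by positivity) (by positivity),
      Real.log_div (by positivity) (by positivity)]
    ring
  have hint₁ : Integrable (fun p : 𝓧 × ℝ => 1 / 2 * Real.log (w / v) -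
      (p.2 - m₁ p.1) ^ 2 / (2 * v)) (ρ ⊗ₘ κ) := (integrable_const _).sub (i₁.div_const _)
  have hint : Integrable (fun p : 𝓧 × ℝ => 1 / 2 * Real.log (w / v) -
      (p.2 - m₁ p.1) ^ 2 / (2 * v) + (p.2 - m₂ p.1) ^ 2 / (2 * w)) (ρ ⊗ₘ κ) :=
    hint₁.add (i₂.div_const _)
  refine ⟨klDiv_ne_top hac ((integrable_congr hllr).2 hint), ?_⟩
  -- The quadratic terms have means `v / (2v)` and `w / (2w)`, both taken under the first law. They
  -- cancel, and only the logarithm of the variance ratio remains.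
  rw [toReal_klDiv_of_measure_eq hac (by simp), integral_congr_ae hllr,
    integral_add hint₁ (i₂.div_const _),
    integral_sub (integrable_const _) (i₁.div_const _), integral_div, integral_div, e₁, e₂]
  have : (v : ℝ) ≠ 0 := by exact_mod_cast hv
  have : (w : ℝ) ≠ 0 := by exact_mod_cast hw
  simp
  field_simp
  ring

/-- The data processing inequality, applied to the map and to its left inverse. -/
lemma klDiv_map_of_leftInverse (ρ ρ' : Measure 𝓧) [IsFiniteMeasure ρ] [IsFiniteMeasure ρ']
    {Φ : 𝓧 → 𝓨} {Φ' : 𝓨 → 𝓧} (hΦ : Measurable Φ) (hΦ' : Measurable Φ')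
    (hinv : Function.LeftInverse Φ' Φ) :
    klDiv (ρ.map Φ) (ρ'.map Φ) = klDiv ρ ρ' := by
  refine le_antisymm (klDiv_map_le ρ ρ' hΦ) ?_
  have h := klDiv_map_le (ρ.map Φ) (ρ'.map Φ) hΦ'
  rwa [Measure.map_map hΦ' hΦ, Measure.map_map hΦ' hΦ, hinv.comp_eq_id, Measure.map_id,
    Measure.map_id] at h

end GaussianKernel

/-! ### Building up the observations one at a time -/

section ObservationLaw

variable {𝒜 : Type*} [Fintype 𝒜]

/-- The information collected by the actions `a`, as a sum of contributions of single
observations. -/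
noncomputable def infoSum (v : NNReal) (ν : Measure (𝒜 → ℝ)) : (t : ℕ) → (Fin t → 𝒜) → ℝ
  | 0, _ => 0
  | t + 1, a => infoSum v ν t (Fin.init a) +
      1 / 2 * Real.log (1 + postVar v ν t (Fin.init a) (a (Fin.last t)) / v)

lemma measurable_obs {t : ℕ} (a : Fin t → 𝒜) :
    Measurable fun x : (𝒜 → ℝ) × (Fin t → ℝ) => (x.1, fun i => x.1 (a i) + x.2 i) :=
  measurable_fst.prodMk (measurable_pi_lambda _ fun i =>
    ((measurable_pi_apply (a i)).comp measurable_fst).add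
      ((measurable_pi_apply i).comp measurable_snd))

variable (P : Measure (𝒜 → ℝ)) [IsProbabilityMeasure P] (σ : ℝ) {t : ℕ}

instance (a : Fin t → 𝒜) : IsProbabilityMeasure (obsLaw P σ a) :=
  Measure.isProbabilityMeasure_map (measurable_obs a).aemeasurable

lemma fst_obsLaw (a : Fin t → 𝒜) : (obsLaw P σ a).fst = P := by
  rw [obsLaw, Measure.fst, Measure.map_map measurable_fst (measurable_obs a)]
  exact Measure.fst_prod

/-- Append an observation to a vector of observations. -/
def appendObs (x : ((𝒜 → ℝ) × (Fin t → ℝ)) × ℝ) : (𝒜 → ℝ) × (Fin (t + 1) → ℝ) :=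
  (x.1.1, Fin.snoc x.1.2 x.2)

/-- Split off the last observation. -/
def splitObs (x : (𝒜 → ℝ) × (Fin (t + 1) → ℝ)) : ((𝒜 → ℝ) × (Fin t → ℝ)) × ℝ :=
  ((x.1, Fin.init x.2), x.2 (Fin.last t))

lemma measurable_appendObs :
    Measurable (appendObs : ((𝒜 → ℝ) × (Fin t → ℝ)) × ℝ → (𝒜 → ℝ) × (Fin (t + 1) → ℝ)) :=
  measurable_fst.fst.prodMk (measurable_snoc.comp (measurable_fst.snd.prodMk measurable_snd))

lemma measurable_splitObs :
    Measurable (splitObs : (𝒜 → ℝ) × (Fin (t + 1) → ℝ) → ((𝒜 → ℝ) × (Fin t → ℝ)) × ℝ) :=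
  (measurable_fst.prodMk (measurable_init.comp measurable_snd)).prodMk
    ((measurable_pi_apply _).comp measurable_snd)

lemma appendObs_splitObs (x : (𝒜 → ℝ) × (Fin (t + 1) → ℝ)) : appendObs (splitObs x) = x := by
  simp [appendObs, splitObs]

lemma splitObs_appendObs (x : ((𝒜 → ℝ) × (Fin t → ℝ)) × ℝ) : splitObs (appendObs x) = x := by
  simp [appendObs, splitObs]

lemma measurable_lastMean (a : Fin (t + 1) → 𝒜) :
    Measurable fun x : (𝒜 → ℝ) × (Fin t → ℝ) => x.1 (a (Fin.last t)) :=
  (measurable_pi_apply _).comp measurable_fst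

lemma measurable_appendNext (a : Fin (t + 1) → 𝒜) :
    Measurable fun x : ((𝒜 → ℝ) × (Fin t → ℝ)) × ℝ =>
      appendObs (x.1, x.1.1 (a (Fin.last t)) + x.2) :=
  measurable_appendObs.comp (measurable_fst.prodMk
    (((measurable_lastMean a).comp measurable_fst).add measurable_snd))

/-- The law of the observations is built up one observation at a time. -/
lemma obsLaw_succ (a : Fin (t + 1) → 𝒜) :
    obsLaw P σ a = ((obsLaw P σ (Fin.init a)).prod (gaussianReal 0 (σ ^ 2).toNNReal)).map
      fun x => appendObs (x.1, x.1.1 (a (Fin.last t)) + x.2) := by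
  have hpi := measurePreserving_piFinSuccAbove
    (fun _ : Fin (t + 1) => gaussianReal 0 (σ ^ 2).toNNReal) (Fin.last t)
  have hm := measurable_appendNext a
  refine Measure.ext_of_lintegral _ fun F hF => ?_
  have hFm : Measurable fun x : ((𝒜 → ℝ) × (Fin t → ℝ)) × ℝ =>
      F (appendObs (x.1, x.1.1 (a (Fin.last t)) + x.2)) := hF.comp hm
  have hFa : Measurable fun x : (𝒜 → ℝ) × (Fin (t + 1) → ℝ) =>
      F (x.1, fun i => x.1 (a i) + x.2 i) := hF.comp (measurable_obs a)
  have hFi : Measurable fun x : (𝒜 → ℝ) × (Fin t → ℝ) =>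
      ∫⁻ e, F (appendObs ((x.1, fun i => x.1 (Fin.init a i) + x.2 i),
        x.1 (a (Fin.last t)) + e)) ∂gaussianReal 0 (σ ^ 2).toNNReal := (hFm.lintegral_prod_right' (ν := gaussianReal 0 (σ ^ 2).toNNReal)).comp
    (measurable_obs (Fin.init a))
  rw [obsLaw, lintegral_map hF (measurable_obs a), lintegral_prod _ hFa.aemeasurable,
    lintegral_map hF hm, lintegral_prod _ hFm.aemeasurable, obsLaw,
    lintegral_map (hFm.lintegral_prod_right') (measurable_obs _),
    lintegral_prod _ hFi.aemeasurable]
  refine lintegral_congr fun g => ?_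
  let G : ℝ × (Fin t → ℝ) → ℝ≥0∞ := fun q =>
    F (appendObs ((g, fun i => g (a i.castSucc) + q.2 i), g (a (Fin.last t)) + q.1))
  have hG : Measurable G := by
    refine hF.comp (measurable_appendObs.comp ((measurable_const.prodMk
      (measurable_pi_lambda _ fun i => ?_)).prodMk (measurable_fst.const_add _)))
    exact ((measurable_pi_apply i).comp measurable_snd).const_add _
  have e := hpi.lintegral_comp hG
  -- `piFinSuccAbove` puts the separated last noise variable in the first factor, whereas here it is
  -- integrated innermost.
  rw [lintegral_prod_symm _ hG.aemeasurable] at e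
  refine Eq.trans (lintegral_congr fun y => ?_) e
  change F _ = F _
  congr 1
  refine Prod.ext rfl (funext fun i => ?_)
  induction i using Fin.lastCases with
  | last => simp [appendObs, MeasurableEquiv.piFinSuccAbove]
  | cast i => simp [appendObs, MeasurableEquiv.piFinSuccAbove, Fin.init]

lemma map_splitObs_obsLaw (a : Fin (t + 1) → 𝒜) :
    (obsLaw P σ a).map splitObs = obsLaw P σ (Fin.init a) ⊗ₘ
      gaussianKernel _ (measurable_lastMean a) (σ ^ 2).toNNReal := by
  have hm := measurable_appendNext a
  rw [obsLaw_succ, Measure.map_map measurable_splitObs hm, compProd_gaussianKernel]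
  congr 1
  funext x
  exact splitObs_appendObs _

end ObservationLaw

/-! ### Chain rule for the information gain -/

section InfoGain

variable {𝒜 : Type*} [Fintype 𝒜] [MeasurableSpace 𝒜] [MeasurableSingletonClass 𝒜]
  (P : Measure (𝒜 → ℝ)) [IsGaussian P] {σ : ℝ} {t : ℕ}

/-- The deviation of the random function from its posterior mean given the observations. -/
noncomputable def obsResidual (v : NNReal) (a : Fin t → 𝒜) (x : (𝒜 → ℝ) × (Fin t → ℝ)) :
    𝒜 → ℝ :=
  fun b => x.1 b - postMean v (centeredLaw P) (mean P) t a x.2 b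

lemma measurable_obsMean (v : NNReal) (a : Fin t → 𝒜) (b : 𝒜) :
    Measurable fun y : Fin t → ℝ => postMean v (centeredLaw P) (mean P) t a y b :=
  (measurable_pi_apply b).comp
    ((measurable_postMean v (centeredLaw P) (mean P) t).comp measurable_prodMk_left)

lemma measurable_obsResidual (v : NNReal) (a : Fin t → 𝒜) : Measurable (obsResidual P v a) :=
  measurable_pi_lambda _ fun b => ((measurable_pi_apply b).comp measurable_fst).sub
    ((measurable_obsMean P v a b).comp measurable_snd)

/-- The innovation of an additional observation is independent of the earlier observations and of
the new residual. -/
lemma hasCondDistrib_obsInnovation (hσ : 0 < σ) (a : Fin (t + 1) → 𝒜)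
    (h : HasCondDistrib (obsResidual P (σ ^ 2).toNNReal (Fin.init a)) Prod.snd
      (Kernel.const _ (residualLaw (σ ^ 2).toNNReal (centeredLaw P) t (Fin.init a)))
      (obsLaw P σ (Fin.init a))) :
    HasCondDistrib
      (fun p : ((𝒜 → ℝ) × (Fin t → ℝ)) × ℝ =>
        (p.1.1 (a (Fin.last t)) + p.2 - postMean (σ ^ 2).toNNReal (centeredLaw P) (mean P) t
          (Fin.init a) p.1.2 (a (Fin.last t)),
        obsResidual P (σ ^ 2).toNNReal a (appendObs (p.1, p.1.1 (a (Fin.last t)) + p.2))))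
      (fun p => p.1.2)
      (Kernel.const _ ((gaussianReal 0 ((postVar (σ ^ 2).toNNReal (centeredLaw P) t (Fin.init a)
        (a (Fin.last t))).toNNReal + (σ ^ 2).toNNReal)).prod
          (residualLaw (σ ^ 2).toNNReal (centeredLaw P) (t + 1) a)))
      ((obsLaw P σ (Fin.init a)).prod (gaussianReal 0 (σ ^ 2).toNNReal)) := by
  set v := (σ ^ 2).toNNReal with hv_def
  have hv : v ≠ 0 := by simpa [hv_def] using hσ.ne'
  have hG := isCenteredGaussian_centeredLaw P
  have := (hG.residualLaw v t (Fin.init a)).isProbabilityMeasure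
  set ρ := obsLaw P σ (Fin.init a)
  set η := gaussianReal 0 v
  have hc : Measurable fun _ : Fin t → ℝ => (Fin.init a : Fin t → 𝒜) := measurable_const
  have hZ : HasCondDistrib (fun p : ((𝒜 → ℝ) × (Fin t → ℝ)) × ℝ =>
      obsResidual P v (Fin.init a) p.1) (fun p => p.1.2)
      ((residualKernel v (centeredLaw P) t).comap _ hc) (ρ.prod η) := by
    have hfst : HasLaw (Prod.fst : ((𝒜 → ℝ) × (Fin t → ℝ)) × ℝ → _) ρ (ρ.prod η) :=
      ⟨by fun_prop, by simp [Measure.map_fst_prod]⟩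
    have e : (ρ.prod η).map (fun p => p.1.2) = ρ.map Prod.snd := by
      rw [← hfst.map_eq, Measure.map_map measurable_snd measurable_fst, hfst.map_eq]
      rfl
    have := HasLaw.comp h hfst
    rw [← e] at this
    exact this
  have hε : HasLaw (Prod.snd : ((𝒜 → ℝ) × (Fin t → ℝ)) × ℝ → ℝ) η (ρ.prod η) :=
    ⟨by fun_prop, by simp [Measure.map_snd_prod]⟩
  have hind : IndepFun (Prod.snd : ((𝒜 → ℝ) × (Fin t → ℝ)) × ℝ → ℝ)
      (fun p => (p.1.2, obsResidual P v (Fin.init a) p.1)) (ρ.prod η) :=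
    (indepFun_prod (μ := ρ) (ν := η) (X := fun x => (x.2, obsResidual P v (Fin.init a) x))
      (Y := fun e => e) (measurable_snd.prodMk (measurable_obsResidual P v _))
      measurable_id).symm
  -- The actions are fixed here, so the condition consists of the observations and the action
  -- sequence is a constant function of it.
  have hinn := hG.hasCondDistrib_innovation hv (c := fun _ : Fin t → ℝ => a) measurable_const hZ hε hind
  convert hinn using 1
  · funext p
    refine Prod.ext ?_ (funext fun b => ?_)
    · simp only [obsResidual]
      ring
    · simp only [obsResidual, appendObs, postMean, residual, Fin.init_snoc, Fin.snoc_last]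
      ring
  · rfl

/-- The residual is independent of the observations. -/
lemma hasCondDistrib_obsResidual (hσ : 0 < σ) (a : Fin t → 𝒜) :
    HasCondDistrib (obsResidual P (σ ^ 2).toNNReal a) Prod.snd
      (Kernel.const _ (residualLaw (σ ^ 2).toNNReal (centeredLaw P) t a)) (obsLaw P σ a) := by
  have hG := isCenteredGaussian_centeredLaw P
  induction t with
  | zero =>
    have := (hG.residualLaw (σ ^ 2).toNNReal 0 a).isProbabilityMeasure
    refine .of_lintegral measurable_snd.aemeasurable
      (measurable_obsResidual P _ a).aemeasurable fun F hF => ?_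
    have hm : Measurable fun (z : 𝒜 → ℝ) b => z b - mean P b :=
      measurable_pi_lambda _ fun b => (measurable_pi_apply b).sub_const _
    have hFm : Measurable fun z : 𝒜 → ℝ => F (default, fun b => z b - mean P b) :=
      hF.comp (measurable_const.prodMk hm)
    have e1 : ∀ x : (𝒜 → ℝ) × (Fin 0 → ℝ), F (x.2, obsResidual P (σ ^ 2).toNNReal a x) =
        F (default, fun b => x.1 b - mean P b) := fun x => by
      rw [Subsingleton.elim x.2 default]
      rfl
    have e2 : ∀ y : Fin 0 → ℝ, ∫⁻ z, F (y, z) ∂(Kernel.const (Fin 0 → ℝ)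
        (residualLaw (σ ^ 2).toNNReal (centeredLaw P) 0 a) y) =
        ∫⁻ z, F (default, z) ∂centeredLaw P := fun y => by
      rw [Subsingleton.elim y default]
      rfl
    have := Measure.isProbabilityMeasure_map (μ := obsLaw P σ a)
      (measurable_snd (α := 𝒜 → ℝ) (β := Fin 0 → ℝ)).aemeasurable
    simp_rw [e1, e2]
    rw [lintegral_const, measure_univ, mul_one, centeredLaw, lintegral_map (by fun_prop) hm,
      ← lintegral_map hFm measurable_fst]
    have := fst_obsLaw P σ a
    rw [Measure.fst] at this
    rw [this]
  | succ t ih =>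
    have := (hG.residualLaw (σ ^ 2).toNNReal (t + 1) a).isProbabilityMeasure
    have hinn := hasCondDistrib_obsInnovation P hσ a (ih (Fin.init a))
    set v := (σ ^ 2).toNNReal
    set w := (postVar v (centeredLaw P) t (Fin.init a) (a (Fin.last t))).toNNReal + v
    have hk : Kernel.const (Fin t → ℝ) ((gaussianReal 0 w).prod
        (residualLaw v (centeredLaw P) (t + 1) a)) =
        Kernel.const (Fin t → ℝ) (gaussianReal 0 w) ⊗ₖ
          Kernel.const ((Fin t → ℝ) × ℝ) (residualLaw v (centeredLaw P) (t + 1) a) := by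
      ext1 y
      rw [Kernel.compProd_apply_eq_compProd_sectR, Kernel.const_apply, Kernel.const_apply]
      have : Kernel.sectR (Kernel.const ((Fin t → ℝ) × ℝ)
          (residualLaw v (centeredLaw P) (t + 1) a)) y =
          Kernel.const ℝ (residualLaw v (centeredLaw P) (t + 1) a) := rfl
      rw [this, Measure.compProd_const]
    rw [hk] at hinn
    have hlast := hinn.of_compProd
    -- Earlier observations and the innovation determine the extended observation vector.
    let G : (Fin t → ℝ) × ℝ → Fin (t + 1) → ℝ := fun q => Fin.snoc q.1
      (q.2 + postMean v (centeredLaw P) (mean P) t (Fin.init a) q.1 (a (Fin.last t)))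
    have hGm : Measurable G := measurable_snoc.comp (measurable_fst.prodMk
      (measurable_snd.add ((measurable_obsMean P v _ _).comp measurable_fst)))
    have hfin := HasCondDistrib.comp_right (f := G) (hf := hGm)
      (κ := Kernel.const _ (residualLaw v (centeredLaw P) (t + 1) a)) hlast
    have hsucc : HasLaw (fun x : ((𝒜 → ℝ) × (Fin t → ℝ)) × ℝ =>
        appendObs (x.1, x.1.1 (a (Fin.last t)) + x.2)) (obsLaw P σ a)
        ((obsLaw P σ (Fin.init a)).prod (gaussianReal 0 v)) :=
      ⟨(measurable_appendNext a).aemeasurable, (obsLaw_succ P σ a).symm⟩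
    refine ⟨(measurable_snd.prodMk (measurable_obsResidual P v a)).aemeasurable, ?_⟩
    have e : (obsLaw P σ a).map Prod.snd =
        ((obsLaw P σ (Fin.init a)).prod (gaussianReal 0 v)).map (G ∘ fun p =>
          (p.1.2, p.1.1 (a (Fin.last t)) + p.2 - postMean v (centeredLaw P) (mean P) t
          (Fin.init a) p.1.2 (a (Fin.last t)))) := by
      rw [← hsucc.map_eq, Measure.map_map measurable_snd (measurable_appendNext a)]
      congr 1
      funext p
      simp [G, appendObs]
    rw [e, ← hfin.map_eq, ← hsucc.map_eq, Measure.map_map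
      (measurable_snd.prodMk (measurable_obsResidual P v a)) (measurable_appendNext a)]
    congr 1
    funext p
    simp [G, appendObs]

/-- The predictive law of the last observation. -/
lemma map_splitObs_prod (hσ : 0 < σ) (a : Fin (t + 1) → 𝒜) :
    (P.prod (obsLaw P σ a).snd).map splitObs =
      (P.prod (obsLaw P σ (Fin.init a)).snd) ⊗ₘ
        gaussianKernel _ ((measurable_obsMean P (σ ^ 2).toNNReal (Fin.init a)
          (a (Fin.last t))).comp (measurable_snd (α := 𝒜 → ℝ)))
          ((postVar (σ ^ 2).toNNReal (centeredLaw P) t (Fin.init a)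
            (a (Fin.last t))).toNNReal + (σ ^ 2).toNNReal) := by
  have hG := isCenteredGaussian_centeredLaw P
  have := (hG.residualLaw (σ ^ 2).toNNReal (t + 1) a).isProbabilityMeasure
  have hinn := hasCondDistrib_obsInnovation P hσ a
    (hasCondDistrib_obsResidual P hσ (Fin.init a))
  set v := (σ ^ 2).toNNReal
  set w := (postVar v (centeredLaw P) t (Fin.init a) (a (Fin.last t))).toNNReal + v
  set ρ := (obsLaw P σ (Fin.init a)).prod (gaussianReal 0 v)
  have hmean := measurable_obsMean P v (Fin.init a) (a (Fin.last t))
  have hnext : HasCondDistrib (fun p : ((𝒜 → ℝ) × (Fin t → ℝ)) × ℝ =>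
      p.1.1 (a (Fin.last t)) + p.2) (fun p => p.1.2) (gaussianKernel _ hmean w) ρ := by
    have := hinn.map_joint (Φ := fun q => postMean v (centeredLaw P) (mean P) t
      (Fin.init a) q.1 (a (Fin.last t)) + q.2.1) (η := gaussianKernel _ hmean w)
      ((hmean.comp measurable_fst).add measurable_snd.fst) fun y => by
        change gaussianReal _ w = Measure.map _ (Measure.prod _ _)
        have e := gaussianReal_map_const_add (μ := 0) (v := w)
          (postMean v (centeredLaw P) (mean P) t (Fin.init a) y (a (Fin.last t)))
        rw [zero_add] at e
        rw [← e]
        have : (fun q : ℝ × (𝒜 → ℝ) => postMean v (centeredLaw P) (mean P) t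
            (Fin.init a) y (a (Fin.last t)) + q.1) = (fun r => postMean v (centeredLaw P)
            (mean P) t (Fin.init a) y (a (Fin.last t)) + r) ∘ Prod.fst := rfl
        rw [this, ← Measure.map_map (by fun_prop) measurable_fst, Measure.map_fst_prod]
        simp
    simpa using this
  have hy : ρ.map (fun p => p.1.2) = (obsLaw P σ (Fin.init a)).snd := by
    have : (fun p : ((𝒜 → ℝ) × (Fin t → ℝ)) × ℝ => p.1.2) = Prod.snd ∘ Prod.fst := rfl
    rw [this, ← Measure.map_map measurable_snd measurable_fst, Measure.map_fst_prod]
    simp [Measure.snd]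
  have hsnd : (obsLaw P σ a).snd =
      ((obsLaw P σ (Fin.init a)).snd ⊗ₘ gaussianKernel _ hmean w).map
        fun q => (Fin.snoc q.1 q.2 : Fin (t + 1) → ℝ) := by
    rw [← hy, ← hnext.map_eq, obsLaw_succ, Measure.snd,
      Measure.map_map measurable_snd (measurable_appendNext a),
      AEMeasurable.map_map_of_aemeasurable measurable_snoc.aemeasurable hnext.aemeasurable]
    rfl
  refine Measure.ext_of_lintegral _ fun F hF => ?_
  have hFs := hF.comp (measurable_splitObs (𝒜 := 𝒜) (t := t))
  have h1 := hF.lintegral_kernel_prod_right' (κ := gaussianKernel _ (hmean.comp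
    (measurable_snd (α := 𝒜 → ℝ))) w)
  rw [lintegral_map hF measurable_splitObs]
  change ∫⁻ x, (F ∘ splitObs) x ∂_ = _
  rw [lintegral_prod _ hFs.aemeasurable, Measure.lintegral_compProd hF,
    lintegral_prod _ h1.aemeasurable]
  refine lintegral_congr fun g => ?_
  have hFg : Measurable fun q : (Fin t → ℝ) × ℝ => F ((g, q.1), q.2) := by fun_prop
  have hFy : Measurable fun y : Fin (t + 1) → ℝ => F (splitObs (g, y)) :=
    hFs.comp measurable_prodMk_left
  change ∫⁻ y, F (splitObs (g, y)) ∂_ = _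
  rw [hsnd, lintegral_map hFy measurable_snoc]
  change ∫⁻ q : (Fin t → ℝ) × ℝ, F (splitObs (appendObs ((g, q.1), q.2))) ∂_ = _
  simp_rw [splitObs_appendObs]
  rw [Measure.lintegral_compProd hFg]
  rfl

/-- The information gain is the sum of the information contents of the single observations. -/
theorem klDiv_obsLaw (hσ : 0 < σ) (a : Fin t → 𝒜) :
    klDiv (obsLaw P σ a) ((obsLaw P σ a).fst.prod (obsLaw P σ a).snd) ≠ ∞ ∧
      infoGain P σ a = infoSum (σ ^ 2).toNNReal (centeredLaw P) t a := by
  unfold infoGain mutualInfo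
  rw [fst_obsLaw]
  induction t with
  | zero =>
    have : obsLaw P σ a = P.prod (obsLaw P σ a).snd := by
      have e : obsLaw P σ a = P.prod (Measure.pi fun _ : Fin 0 =>
          gaussianReal 0 (σ ^ 2).toNNReal) := by
        rw [obsLaw]
        convert Measure.map_id
        rename_i x
        exact Prod.ext rfl (Subsingleton.elim _ _)
      rw [e]
      simp
    rw [← this, klDiv_self]
    simp [infoSum]
  | succ t ih =>
    obtain ⟨ih₁, ih₂⟩ := ih (Fin.init a)
    have hG := isCenteredGaussian_centeredLaw P
    have := (hG.residualLaw (σ ^ 2).toNNReal (t + 1) a).isProbabilityMeasure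
    have hinn := hasCondDistrib_obsInnovation P hσ a
      (hasCondDistrib_obsResidual P hσ (Fin.init a))
    have hsplit : klDiv (obsLaw P σ a) (P.prod (obsLaw P σ a).snd) =
        klDiv ((obsLaw P σ a).map splitObs) ((P.prod (obsLaw P σ a).snd).map splitObs) :=
      (klDiv_map_of_leftInverse _ _ measurable_splitObs measurable_appendObs
        appendObs_splitObs).symm
    -- Chain rule: given the function, the last observation has variance `v` around its true value;
    -- under the product of the marginals it follows the predictive law, centered at the posterior
    -- mean with variance `s + v`.
    rw [hsplit, map_splitObs_obsLaw, map_splitObs_prod P hσ, klDiv_compProd_eq_add]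
    have hv : (σ ^ 2).toNNReal ≠ 0 := by simpa using hσ.ne'
    set v := (σ ^ 2).toNNReal
    set s := postVar v (centeredLaw P) t (Fin.init a) (a (Fin.last t)) with hs
    have hw : s.toNNReal + v ≠ 0 := by positivity
    -- The first component of the innovation pair is the prediction error under the true joint law;
    -- its Gaussian law of variance `s + v` is what `klDiv_gaussianKernel` requires.
    have hlaw := hinn.fst
    have hc : (Kernel.const (Fin t → ℝ) ((gaussianReal 0 (s.toNNReal + v)).prod
        (residualLaw v (centeredLaw P) (t + 1) a))).fst =
        Kernel.const _ (gaussianReal 0 (s.toNNReal + v)) := by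
      ext1 y
      rw [Kernel.fst_apply, Kernel.const_apply, Measure.map_fst_prod]
      simp
    rw [hc] at hlaw
    have hlaw := hlaw.hasLaw_of_const
    have hmean := measurable_obsMean P v (Fin.init a) (a (Fin.last t))
    obtain ⟨k₁, k₂⟩ := klDiv_gaussianKernel (obsLaw P σ (Fin.init a)) (measurable_lastMean a)
      (hmean.comp (measurable_snd (α := 𝒜 → ℝ))) hv hw (by
        have hm : Measurable fun p : ((𝒜 → ℝ) × (Fin t → ℝ)) × ℝ => p.2 -
            postMean v (centeredLaw P) (mean P) t (Fin.init a) p.1.2 (a (Fin.last t)) :=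
          measurable_snd.sub (hmean.comp measurable_fst.snd)
        refine ⟨hm.aemeasurable, ?_⟩
        rw [compProd_gaussianKernel, ← hlaw.map_eq]
        exact Measure.map_map hm (measurable_fst.prodMk
          (((measurable_lastMean a).comp measurable_fst).add measurable_snd)))
    refine ⟨ENNReal.add_ne_top.2 ⟨ih₁, k₁⟩, ?_⟩
    rw [ENNReal.toReal_add ih₁ k₁, ih₂, k₂, infoSum, ← hs]
    congr 3
    have hv' : (v : ℝ) ≠ 0 := by exact_mod_cast hv
    have hs0 : 0 ≤ s := postVar_nonneg _ _ _ _ _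
    rw [NNReal.coe_add, Real.coe_toNNReal _ hs0]
    field_simp
    ring

end InfoGain

/-! ### Gaussian excess and a logarithmic inequality -/

section Analysis

/-- An explicit primitive of `x` times the density, which evaluates the tail integral in
`integral_excess_gaussianReal_le`. -/
lemma hasDerivAt_gaussianPDFReal {w : NNReal} (hw : w ≠ 0) (x : ℝ) :
    HasDerivAt (fun x => -((w : ℝ) * gaussianPDFReal 0 w x)) (gaussianPDFReal 0 w x * x) x := by
  have hw' : (w : ℝ) ≠ 0 := by exact_mod_cast hw
  have h1 : HasDerivAt (fun x : ℝ => -(x - 0) ^ 2 / (2 * (w : ℝ))) (-x / w) x := by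
    refine ((((hasDerivAt_id x).sub_const 0).fun_pow 2).fun_neg.div_const
      (2 * (w : ℝ))).congr_deriv ?_
    simp only [id, sub_zero]
    field_simp
    norm_num
  refine ((h1.exp.const_mul (Real.sqrt (2 * Real.pi * w))⁻¹).const_mul
    (w : ℝ)).fun_neg.congr_deriv ?_
  simp only [gaussianPDFReal]
  field_simp

lemma tendsto_gaussianPDFReal_atTop {w : NNReal} (hw : w ≠ 0) :
    Filter.Tendsto (fun x => -((w : ℝ) * gaussianPDFReal 0 w x)) Filter.atTop (nhds 0) := by
  have hw' : (0 : ℝ) < w := by positivity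
  have h1 : Filter.Tendsto (fun x : ℝ => -(x - 0) ^ 2 / (2 * (w : ℝ))) Filter.atTop
      Filter.atBot := by
    have : Filter.Tendsto (fun x : ℝ => (x - 0) ^ 2 / (2 * (w : ℝ))) Filter.atTop
        Filter.atTop := by
      simpa using (Filter.tendsto_pow_atTop (two_ne_zero)).atTop_div_const
        (show (0 : ℝ) < 2 * w by positivity)
    simp only [neg_div]
    exact Filter.tendsto_neg_atTop_atBot.comp this
  have h2 := (((Real.tendsto_exp_atBot.comp h1).const_mul
    (Real.sqrt (2 * Real.pi * w))⁻¹).const_mul (w : ℝ)).neg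
  simpa [gaussianPDFReal, Function.comp_def] using h2

/-- The expected excess of a centered Gaussian variable over `r` standard deviations. -/
lemma integral_excess_gaussianReal_le (w : NNReal) {r : ℝ} (hr : 0 ≤ r) :
    ∫ x, max (x - r * Real.sqrt w) 0 ∂gaussianReal 0 w ≤
      Real.sqrt w * (Real.exp (-(r ^ 2 / 2)) / Real.sqrt (2 * Real.pi)) := by
  rcases eq_or_ne w 0 with rfl | hw
  · simp
  have hw' : (0 : ℝ) < w := by positivity
  set c := r * Real.sqrt w
  have hc : 0 ≤ c := by positivity
  have hint : Integrable (fun x => gaussianPDFReal 0 w x * x) := by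
    have h : Integrable (fun x : ℝ => x) (gaussianReal 0 w) :=
      (memLp_id_gaussianReal (μ := 0) (v := w) 1).integrable le_rfl
    rw [gaussianReal_of_var_ne_zero _ hw, integrable_withDensity_iff_integrable_smul'
      (measurable_gaussianPDF _ _) (ae_of_all _ fun _ => gaussianPDF_lt_top)] at h
    simpa using h
  have htail : ∫ x in Set.Ioi c, gaussianPDFReal 0 w x * x = w * gaussianPDFReal 0 w c := by
    have := integral_Ioi_of_hasDerivAt_of_tendsto (a := c)
      (hasDerivAt_gaussianPDFReal hw c).continuousAt.continuousWithinAt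
      (fun x _ => hasDerivAt_gaussianPDFReal hw x) hint.integrableOn
      (tendsto_gaussianPDFReal_atTop hw)
    rw [this]
    ring
  -- Above `c` the excess `x - c` is replaced by the larger `x`, using `c ≥ 0`.
  have hle : ∫ x, max (x - c) 0 ∂gaussianReal 0 w ≤ w * gaussianPDFReal 0 w c := by
    rw [integral_gaussianReal_eq_integral_smul hw, ← htail, ← integral_indicator measurableSet_Ioi]
    refine integral_mono_of_nonneg (ae_of_all _ fun x => ?_)
      (hint.indicator measurableSet_Ioi) (ae_of_all _ fun x => ?_)
    · exact mul_nonneg (gaussianPDFReal_nonneg _ _ _) (le_max_right _ _)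
    · by_cases hx : c < x
      · simp only [Set.indicator_of_mem (Set.mem_Ioi.2 hx), smul_eq_mul]
        refine mul_le_mul_of_nonneg_left ?_ (gaussianPDFReal_nonneg _ _ _)
        exact max_le (by linarith) (by linarith)
      · simp [Set.indicator_of_notMem (show x ∉ Set.Ioi c from hx), max_eq_right
          (show x - c ≤ 0 by linarith)]
  refine hle.trans (le_of_eq ?_)
  have hs : Real.sqrt w * Real.sqrt w = w := Real.mul_self_sqrt hw'.le
  have hexp : -(c - 0) ^ 2 / (2 * (w : ℝ)) = -(r ^ 2 / 2) := by
    have : c ^ 2 = r ^ 2 * w := by rw [← hs]; ring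
    rw [sub_zero, this]
    field_simp
  rw [gaussianPDFReal, hexp, Real.sqrt_mul (by positivity) (w : ℝ)]
  have : 0 < Real.sqrt w := by positivity
  nth_rewrite 1 [← hs]
  field_simp

/-- Bernoulli's inequality `(1 + c)^s ≤ 1 + s c` for exponents in `[0, 1]`, after taking logarithms.
-/
lemma mul_log_one_add_le {c s : ℝ} (hc : 0 ≤ c) (hs : 0 ≤ s) (hs1 : s ≤ 1) :
    s * Real.log (1 + c) ≤ Real.log (1 + s * c) := by
  rw [← Real.log_rpow (by positivity)]
  exact Real.log_le_log (by positivity)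
    (rpow_one_add_le_one_add_mul_self (by linarith) hs hs1)

end Analysis

/-! ### Evaluation at a random index in a finite set -/

section RandomIndex

variable {Ω ι : Type*} [MeasurableSpace Ω] [Fintype ι] [MeasurableSpace ι]
  [MeasurableSingletonClass ι] {μ : Measure Ω}

/-- The index may depend on `F` in any way: the evaluation is a finite sum of indicators times
integrable functions. -/
lemma integrable_randomIndex {F : Ω → ι → ℝ} (hF : ∀ i, Integrable (fun ω => F ω i) μ)
    {B : Ω → ι} (hB : Measurable B) : Integrable (fun ω => F ω (B ω)) μ := by
  classical
  have : (fun ω => F ω (B ω)) = fun ω => ∑ i, (B ⁻¹' {i}).indicator (fun ω => F ω i) ω := by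
    funext ω
    rw [Finset.sum_eq_single (B ω)]
    · simp
    · intro i _ hi
      exact Set.indicator_of_notMem (fun h => hi (by simpa using h.symm)) _
    · simp
  rw [this]
  exact integrable_finsetSum _ fun i _ => (hF i).indicator (hB (measurableSet_singleton i))

lemma integrable_comp_finite [IsFiniteMeasure μ] (h : ι → ℝ) {D : Ω → ι} (hD : Measurable D) :
    Integrable (fun ω => h (D ω)) μ :=
  integrable_randomIndex (F := fun _ => h) (fun _ => integrable_const _) hD

lemma integral_of_hasCondDistrib {𝓨 : Type*} [MeasurableSpace 𝓨] [IsProbabilityMeasure μ]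
    {D : Ω → ι} {Z : Ω → 𝓨} {κ : Kernel ι 𝓨} [IsMarkovKernel κ] (h : HasCondDistrib Z D κ μ)
    {ψ : ι → 𝓨 → ℝ} (hψ : ∀ a, Measurable (ψ a)) (hi : ∀ a, Integrable (ψ a) (κ a)) :
    Integrable (fun ω => ψ (D ω) (Z ω)) μ ∧
      ∫ ω, ψ (D ω) (Z ω) ∂μ = ∫ a, ∫ z, ψ a z ∂κ a ∂(μ.map D) := by
  have hm : Measurable fun p : ι × 𝓨 => ψ p.1 p.2 :=
    measurable_from_prod_countable_right hψ
  have hint : Integrable (fun p : ι × 𝓨 => ψ p.1 p.2) (μ.map D ⊗ₘ κ) := by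
    rw [Measure.integrable_compProd_iff hm.aestronglyMeasurable]
    exact ⟨ae_of_all _ hi, Integrable.of_finite⟩
  refine ⟨?_, ?_⟩
  · rw [← h.map_eq] at hint
    exact hint.comp_aemeasurable h.aemeasurable
  · rw [← Measure.integral_compProd hint, ← h.map_eq,
      integral_map h.aemeasurable hm.aestronglyMeasurable]

end RandomIndex

/-! ### Confidence bounds and the regret of posterior sampling -/

section Regret

variable {Ω Θ 𝒜 : Type*} [MeasurableSpace Ω] [MeasurableSpace Θ]
  [Fintype 𝒜] [MeasurableSpace 𝒜] [MeasurableSingletonClass 𝒜]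
  {μ : Measure Ω} [IsProbabilityMeasure μ] {f : Θ → 𝒜 → ℝ} {θ : Ω → Θ}
  {S : ℕ → Ω → Set 𝒜} {A : ℕ → Ω → 𝒜} {R : ℕ → Ω → ℝ}
  {κ : (t : ℕ) → Kernel (Past 𝒜 t) (Set 𝒜)} [∀ t, IsMarkovKernel (κ t)]
  {π : (t : ℕ) → Kernel (Hist 𝒜 t) 𝒜} [∀ t, IsMarkovKernel (π t)] {P : Measure (𝒜 → ℝ)}
  {σ : ℝ}

/-- The sequence of the first `t` actions. -/
def actionsUpTo (A : ℕ → Ω → 𝒜) (t : ℕ) (ω : Ω) : Fin t → 𝒜 := fun i => A i ω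

/-- The posterior standard deviation of coordinate `b` after the actions `a`. -/
noncomputable def postStd (v : NNReal) (ν : Measure (𝒜 → ℝ)) (t : ℕ) (a : Fin t → 𝒜) (b : 𝒜) :
    ℝ :=
  Real.sqrt (postVar v ν t a b)

/-- The upper confidence bound for coordinate `b`, at `r` posterior standard deviations. -/
noncomputable def upperBound (P : Measure (𝒜 → ℝ)) (v : NNReal) (r : ℝ) {t : ℕ} (p : Past 𝒜 t)
    (b : 𝒜) : ℝ :=
  pastMean P v p b + r * postStd v (centeredLaw P) t (pastActions p) b

lemma measurable_upperBound (P : Measure (𝒜 → ℝ)) (v : NNReal) (r : ℝ) {t : ℕ} :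
    Measurable fun x : Hist 𝒜 t × 𝒜 => upperBound P v r x.1.1 x.2 := by
  refine measurable_from_prod_countable_left fun b => ?_
  have h1 : Measurable fun x : Hist 𝒜 t => pastMean P v x.1 b :=
    (measurable_pi_apply b).comp ((measurable_pastMean P v).comp measurable_fst)
  have h2 : Measurable fun x : Hist 𝒜 t =>
      postStd v (centeredLaw P) t (pastActions x.1) b :=
    (measurable_of_finite fun a : Fin t → 𝒜 => postStd v (centeredLaw P) t a b).comp
      (measurable_pastActions.comp measurable_fst)
  exact h1.add (h2.const_mul r)

lemma periodRegret_eq {t : ℕ} {ω : Ω} {b : 𝒜} (hb : b ∈ S t ω)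
    (hmax : ∀ c ∈ S t ω, f (θ ω) c ≤ f (θ ω) b) :
    periodRegret f θ S A t ω = f (θ ω) b - f (θ ω) (A t ω) := by
  have : Nonempty (S t ω) := ⟨⟨b, hb⟩⟩
  rw [periodRegret]
  congr 1
  exact le_antisymm (ciSup_le fun c => hmax c c.2)
    (le_ciSup (f := fun c : S t ω => f (θ ω) c) (Set.finite_range _).bddAbove ⟨b, hb⟩)

lemma infoSum_actionsUpTo (v : NNReal) (ν : Measure (𝒜 → ℝ)) (A : ℕ → Ω → 𝒜) (T : ℕ) (ω : Ω) :
    infoSum v ν T (actionsUpTo A T ω) = ∑ t ∈ Finset.range T,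
      1 / 2 * Real.log (1 + postVar v ν t (actionsUpTo A t ω) (A t ω) / v) := by
  induction T with
  | zero => rfl
  | succ T ih =>
    rw [Finset.sum_range_succ, ← ih]
    rfl

/-- Along every sequence of actions, the posterior standard deviations are controlled by the
maximal information gain. -/
lemma sum_postStd_le [IsGaussian P] (hσ : 0 < σ) (hvar : ∀ b, Var[fun z => z b; P] ≤ 1)
    (A : ℕ → Ω → 𝒜) (T : ℕ) (ω : Ω) :
    ∑ t ∈ Finset.range T,
        postStd (σ ^ 2).toNNReal (centeredLaw P) t (actionsUpTo A t ω) (A t ω) ≤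
      Real.sqrt (T * (2 * maxInfoGain P σ T * (Real.log (1 + (σ ^ 2)⁻¹))⁻¹)) := by
  have hG := isCenteredGaussian_centeredLaw P
  set v := (σ ^ 2).toNNReal with hv_def
  have hvσ : (v : ℝ) = σ ^ 2 := Real.coe_toNNReal _ (sq_nonneg σ)
  have hv : v ≠ 0 := by simpa [hv_def] using hσ.ne'
  have hL : 0 < Real.log (1 + (σ ^ 2)⁻¹) := Real.log_pos (by
    have : 0 < (σ ^ 2)⁻¹ := by positivity
    linarith)
  set s : ℕ → ℝ := fun t => postVar v (centeredLaw P) t (actionsUpTo A t ω) (A t ω)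
  have hs0 (t : ℕ) : 0 ≤ s t := postVar_nonneg _ _ _ _ _
  have hs1 (t : ℕ) : s t ≤ 1 :=
    (hG.postVar_le hv t _ _).trans ((variance_centeredLaw P _).trans_le (hvar _))
  -- The shape `2 * (1 / 2 * log …)` exhibits the single-observation term of `infoSum`. The bound `s
  -- t ≤ 1`, which comes from the prior variances, makes Bernoulli's inequality applicable.
  have hterm (t : ℕ) : s t ≤ 2 * (1 / 2 * Real.log (1 + s t / v)) *
      (Real.log (1 + (σ ^ 2)⁻¹))⁻¹ := by
    rw [← div_eq_mul_inv, le_div_iff₀ hL]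
    have := mul_log_one_add_le (c := (σ ^ 2)⁻¹) (by positivity) (hs0 t) (hs1 t)
    rw [hvσ, div_eq_mul_inv (s t)]
    linarith
  have hsum : ∑ t ∈ Finset.range T, s t ≤
      2 * maxInfoGain P σ T * (Real.log (1 + (σ ^ 2)⁻¹))⁻¹ := by
    refine (Finset.sum_le_sum fun t _ => hterm t).trans ?_
    rw [← Finset.sum_mul, ← Finset.mul_sum, ← infoSum_actionsUpTo]
    -- With `ω` fixed, the realized actions are one of the finitely many deterministic sequences in
    -- the supremum.
    have hgain : infoSum v (centeredLaw P) T (actionsUpTo A T ω) ≤ maxInfoGain P σ T := by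
      rw [← (klDiv_obsLaw P hσ _).2]
      exact le_ciSup (f := fun a : Fin T → 𝒜 => infoGain P σ a) (Set.finite_range _).bddAbove _
    gcongr
  refine Real.le_sqrt_of_sq_le ?_
  have hcs := sq_sum_le_card_mul_sum_sq (s := Finset.range T)
    (f := fun t => postStd v (centeredLaw P) t (actionsUpTo A t ω) (A t ω))
  rw [Finset.card_range] at hcs
  refine hcs.trans (mul_le_mul_of_nonneg_left ?_ (Nat.cast_nonneg T))
  refine le_trans (le_of_eq (Finset.sum_congr rfl fun t _ => ?_)) hsum
  exact Real.sq_sqrt (hs0 t)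

lemma IsInteraction.measurable_actionsUpTo (h : IsInteraction μ f θ S A R κ π) (t : ℕ) :
    Measurable (actionsUpTo A t) :=
  measurable_pi_lambda _ fun i => h.measurable_action i

lemma integrable_postStd (h : IsInteraction μ f θ S A R κ π) (v : NNReal)
    (ν : Measure (𝒜 → ℝ)) (t : ℕ) (b : 𝒜) :
    Integrable (fun ω => postStd v ν t (actionsUpTo A t ω) b) μ :=
  integrable_comp_finite (fun a : Fin t → 𝒜 => postStd v ν t a b)
    (h.measurable_actionsUpTo t)

namespace IsInteraction

variable [IsGaussian P] (h : IsInteraction μ f θ S A R κ π)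
  (hP : HasLaw (fun ω a => f (θ ω) a) P μ) (hσ : 0 < σ) (hn : IsGaussianNoise μ f θ S A R σ)

include h hP hσ hn

/-- The conditional law of the fluctuation given the actions. -/
lemma fluctuation_actionsUpTo (t : ℕ) :
    HasCondDistrib (fluctuation P (σ ^ 2).toNNReal f θ S A R t) (actionsUpTo A (t + 1))
      ((residualKernel (σ ^ 2).toNNReal (centeredLaw P) t).comap Fin.init measurable_init) μ := by
  have hG := isCenteredGaussian_centeredLaw P
  have := hG.isMarkovKernel_residualKernel (σ ^ 2).toNNReal t
  let c : Hist 𝒜 t × 𝒜 → Fin (t + 1) → 𝒜 := fun x => Fin.snoc (pastActions x.1.1) x.2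
  have hc : Measurable c :=
    measurable_snoc.comp ((measurable_pastActions.comp measurable_fst.fst).prodMk measurable_snd)
  have hZ := h.fluctuation_action (h.fluctuation_past hP hσ hn t)
  -- The kernel sees history and action only through the action sequence, so the condition can be
  -- coarsened to that sequence.
  have hk : ((pastKernel P (σ ^ 2).toNNReal t).prodMkRight (Set 𝒜)).prodMkRight 𝒜 =
      ((residualKernel (σ ^ 2).toNNReal (centeredLaw P) t).comap Fin.init
        measurable_init).comap c hc := by
    ext1 x
    simp [pastKernel, c, Kernel.comap_apply]
  rw [hk] at hZ
  convert hZ.comp_right using 1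
  funext ω i
  induction i using Fin.lastCases with
  | last => simp [c, actionsUpTo]
  | cast i => simp [c, actionsUpTo, hist, past, pastActions]

lemma integrable_fluctuation (t : ℕ) (b : 𝒜) :
    Integrable (fun ω => fluctuation P (σ ^ 2).toNNReal f θ S A R t ω b) μ := by
  have hG := isCenteredGaussian_centeredLaw P
  have := hG.isMarkovKernel_residualKernel (σ ^ 2).toNNReal t
  exact (integral_of_hasCondDistrib (h.fluctuation_actionsUpTo hP hσ hn t)
    (ψ := fun _ z => z b) (fun _ => measurable_pi_apply b)
    fun a => (hG.residualLaw _ t (Fin.init a)).integrable_eval b).1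

/-- The selected action is the last entry of the condition, so given the actions a fixed coordinate
of a centered law is integrated. The optimal action depends on the parameter and admits no such
argument. -/
lemma integral_fluctuation_action (t : ℕ) :
    ∫ ω, fluctuation P (σ ^ 2).toNNReal f θ S A R t ω (A t ω) ∂μ = 0 := by
  have hG := isCenteredGaussian_centeredLaw P
  have := hG.isMarkovKernel_residualKernel (σ ^ 2).toNNReal t
  have e := (integral_of_hasCondDistrib (h.fluctuation_actionsUpTo hP hσ hn t)
    (ψ := fun a z => z (a (Fin.last t))) (fun _ => measurable_pi_apply _)
    fun a => (hG.residualLaw _ t (Fin.init a)).integrable_eval _).2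
  refine e.trans (integral_eq_zero_of_ae (ae_of_all _ fun a => ?_))
  exact (hG.residualLaw _ t (Fin.init a)).integral_eq_zero _

/-- Given the actions, coordinate `b` is centered Gaussian with standard deviation `postStd ≤ 1`.
The Gaussian excess bound is therefore uniform over action sequences and survives averaging over
them. -/
lemma integral_excess_le (hvar : ∀ b, Var[fun z => z b; P] ≤ 1) {r : ℝ} (hr : 0 ≤ r) (t : ℕ)
    (b : 𝒜) :
    Integrable (fun ω => max (fluctuation P (σ ^ 2).toNNReal f θ S A R t ω b -
      r * postStd (σ ^ 2).toNNReal (centeredLaw P) t (actionsUpTo A t ω) b) 0) μ ∧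
    ∫ ω, max (fluctuation P (σ ^ 2).toNNReal f θ S A R t ω b -
      r * postStd (σ ^ 2).toNNReal (centeredLaw P) t (actionsUpTo A t ω) b) 0 ∂μ ≤
      Real.exp (-(r ^ 2 / 2)) / Real.sqrt (2 * Real.pi) := by
  have hG := isCenteredGaussian_centeredLaw P
  have := hG.isMarkovKernel_residualKernel (σ ^ 2).toNNReal t
  set v := (σ ^ 2).toNNReal with hv_def
  have hv : v ≠ 0 := by simpa [hv_def] using hσ.ne'
  obtain ⟨hi, he⟩ := integral_of_hasCondDistrib (h.fluctuation_actionsUpTo hP hσ hn t)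
    (ψ := fun a z => max (z b - r * postStd v (centeredLaw P) t (Fin.init a) b) 0)
    (fun _ => ((measurable_pi_apply b).sub_const _).max measurable_const)
    fun a => by
      have hR := hG.residualLaw v t (Fin.init a)
      have := hR.isProbabilityMeasure
      exact ((hR.integrable_eval b).sub (integrable_const _)).sup (integrable_const 0)
  refine ⟨hi, he.trans_le ?_⟩
  have := Measure.isProbabilityMeasure_map (μ := μ) (f := actionsUpTo A (t + 1))
    (h.measurable_actionsUpTo (t + 1)).aemeasurable
  have hbound (a : Fin (t + 1) → 𝒜) :
      ∫ z, max (z b - r * postStd v (centeredLaw P) t (Fin.init a) b) 0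
        ∂(residualLaw v (centeredLaw P) t (Fin.init a)) ≤
      Real.exp (-(r ^ 2 / 2)) / Real.sqrt (2 * Real.pi) := by
    have hR := hG.residualLaw v t (Fin.init a)
    set s := postVar v (centeredLaw P) t (Fin.init a) b with hs
    have hs0 : 0 ≤ s := postVar_nonneg _ _ _ _ _
    have hs1 : s ≤ 1 := (hG.postVar_le hv t _ _).trans ((variance_centeredLaw P _).trans_le
      (hvar _))
    have hmap := integral_map (μ := residualLaw v (centeredLaw P) t (Fin.init a))
      (φ := fun z => z b) (f := fun x => max (x - r * Real.sqrt s) 0)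
      (measurable_pi_apply b).aemeasurable (by fun_prop)
    have hle := integral_excess_gaussianReal_le s.toNNReal hr
    rw [Real.coe_toNNReal _ hs0] at hle
    rw [hR.map_eval b] at hmap
    refine (hmap.symm.trans_le hle).trans (mul_le_of_le_one_left (by positivity) ?_)
    exact Real.sqrt_le_one.2 hs1
  calc _ ≤ ∫ _, Real.exp (-(r ^ 2 / 2)) / Real.sqrt (2 * Real.pi)
        ∂(μ.map (actionsUpTo A (t + 1))) :=
        integral_mono Integrable.of_finite (integrable_const _) hbound
    _ = _ := by simp

lemma integrable_reward (b : 𝒜) : Integrable (fun ω => f (θ ω) b) μ :=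
  (hP.hasGaussianLaw.map_fun (ContinuousLinearMap.proj b)).integrable

/-- The regret of one period of posterior sampling. -/
lemma integral_periodRegret_le (hps : IsPosteriorSampling μ f θ S A R π)
    (hvar : ∀ b, Var[fun z => z b; P] ≤ 1) {r : ℝ} (hr : 0 ≤ r) (t : ℕ) :
    Integrable (periodRegret f θ S A t) μ ∧
    ∫ ω, periodRegret f θ S A t ω ∂μ ≤
      Fintype.card 𝒜 * (Real.exp (-(r ^ 2 / 2)) / Real.sqrt (2 * Real.pi)) +
      r * ∫ ω, postStd (σ ^ 2).toNNReal (centeredLaw P) t (actionsUpTo A t ω) (A t ω) ∂μ := by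
  obtain ⟨B, hB, hBmax, hBlaw⟩ := hps t
  have hA := h.measurable_action t
  set v := (σ ^ 2).toNNReal
  set Z := fluctuation P v f θ S A R t with hZ
  set s : Ω → 𝒜 → ℝ := fun ω b => postStd v (centeredLaw P) t (actionsUpTo A t ω) b
  set U : Ω → 𝒜 → ℝ := fun ω b => upperBound P v r (past S A R t ω) b with hU
  have hg := h.integrable_reward hP hσ hn
  have hZi := h.integrable_fluctuation hP hσ hn t
  have hsi (b : 𝒜) : Integrable (fun ω => s ω b) μ := integrable_postStd h v _ t b
  have hdecomp (ω : Ω) (b : 𝒜) : f (θ ω) b = U ω b + (Z ω b - r * s ω b) := by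
    simp only [hU, hZ, upperBound, fluctuation, s]
    have : pastActions (past S A R t ω) = actionsUpTo A t ω := rfl
    rw [this]
    ring
  have hUi (b : 𝒜) : Integrable (fun ω => U ω b) μ := by
    have : (fun ω => U ω b) = fun ω => f (θ ω) b - (Z ω b - r * s ω b) := by
      funext ω
      rw [hdecomp ω b]
      ring
    rw [this]
    exact (hg b).sub ((hZi b).sub ((hsi b).const_mul r))
  -- The only use of the posterior sampling law: `A t` and `B` share the conditional law `π t`, and
  -- `U` is a function of history and action.
  have hUAB : ∫ ω, U ω (B ω) ∂μ = ∫ ω, U ω (A t ω) ∂μ := by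
    have hAlaw : HasCondDistrib (A t) (hist S A R t) (π t) μ :=
      (h.action_law t).comp_right (f := Prod.fst) (hf := measurable_fst)
    have hm := measurable_upperBound P v r (𝒜 := 𝒜) (t := t)
    have e1 := hBlaw.integral_comp hm.aestronglyMeasurable
    have e2 := hAlaw.integral_comp hm.aestronglyMeasurable
    exact e1.trans e2.symm
  have hregret : periodRegret f θ S A t =ᵐ[μ] fun ω => f (θ ω) (B ω) - f (θ ω) (A t ω) := by
    filter_upwards [hBmax] with ω hω using periodRegret_eq hω.1 hω.2
  have hgB := integrable_randomIndex hg hB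
  have hgA := integrable_randomIndex hg hA
  refine ⟨(hgB.sub hgA).congr hregret.symm, ?_⟩
  have hexc := h.integral_excess_le hP hσ hn hvar hr t
  have hWi (b : 𝒜) : Integrable (fun ω => Z ω b - r * s ω b) μ := (hZi b).sub ((hsi b).const_mul r)
  have hgB' : ∫ ω, f (θ ω) (B ω) ∂μ =
      ∫ ω, U ω (B ω) ∂μ + ∫ ω, (Z ω (B ω) - r * s ω (B ω)) ∂μ := by
    rw [← integral_add (integrable_randomIndex hUi hB) (integrable_randomIndex hWi hB)]
    exact integral_congr_ae (ae_of_all _ fun ω => hdecomp ω (B ω))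
  have hgA' : ∫ ω, f (θ ω) (A t ω) ∂μ =
      ∫ ω, U ω (A t ω) ∂μ - r * ∫ ω, s ω (A t ω) ∂μ := by
    have e : ∫ ω, (Z ω (A t ω) - r * s ω (A t ω)) ∂μ = -(r * ∫ ω, s ω (A t ω) ∂μ) := by
      rw [integral_sub (integrable_randomIndex hZi hA)
        ((integrable_randomIndex hsi hA).const_mul r),
        h.integral_fluctuation_action hP hσ hn t, integral_const_mul, zero_sub]
    rw [sub_eq_add_neg, ← e,
      ← integral_add (integrable_randomIndex hUi hA) (integrable_randomIndex hWi hA)]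
    exact integral_congr_ae (ae_of_all _ fun ω => hdecomp ω (A t ω))
  -- Since `B` is correlated with `Z`, its term is dominated by the positive parts summed over all
  -- actions, which costs the factor `|𝒜|`.
  have hWB : ∫ ω, (Z ω (B ω) - r * s ω (B ω)) ∂μ ≤
      Fintype.card 𝒜 * (Real.exp (-(r ^ 2 / 2)) / Real.sqrt (2 * Real.pi)) := by
    calc ∫ ω, (Z ω (B ω) - r * s ω (B ω)) ∂μ
        ≤ ∫ ω, ∑ b, max (Z ω b - r * s ω b) 0 ∂μ := by
          refine integral_mono (integrable_randomIndex hWi hB)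
            (integrable_finsetSum _ fun b _ => (hexc b).1) fun ω => ?_
          exact (le_max_left _ 0).trans (Finset.single_le_sum
            (f := fun b => max (Z ω b - r * s ω b) 0) (fun b _ => le_max_right _ _)
            (Finset.mem_univ (B ω)))
      _ = ∑ b, ∫ ω, max (Z ω b - r * s ω b) 0 ∂μ :=
          integral_finsetSum _ fun b _ => (hexc b).1
      _ ≤ ∑ _b : 𝒜, Real.exp (-(r ^ 2 / 2)) / Real.sqrt (2 * Real.pi) :=
          Finset.sum_le_sum fun b _ => (hexc b).2
      _ = _ := by simp
  rw [integral_congr_ae hregret, integral_sub hgB hgA, hgB', hgA', hUAB]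
  linarith

end IsInteraction

/-- The arithmetic of the final bound, with `K = (T ^ 2 + 1) N / √(2π)` and
`r = √(2 log K)`. -/
lemma card_mul_excess_le_one (T : ℕ) {N : ℕ} (hN : 0 < N) :
    (T : ℝ) * (N * (Real.exp (-(Real.sqrt (2 * Real.log (((T : ℝ) ^ 2 + 1) * N /
      Real.sqrt (2 * Real.pi))) ^ 2 / 2)) / Real.sqrt (2 * Real.pi))) ≤ 1 := by
  set q := Real.sqrt (2 * Real.pi)
  have hq : 0 < q := by positivity
  have hN' : (0 : ℝ) < N := by exact_mod_cast hN
  set K := ((T : ℝ) ^ 2 + 1) * N / q with hK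
  have hK0 : 0 < K := by positivity
  have hT : (T : ℝ) ≤ (T : ℝ) ^ 2 + 1 := by nlinarith [sq_nonneg ((T : ℝ) - 1)]
  have hTN : (T : ℝ) * N / q ≤ K := by
    rw [hK]
    gcongr
  rcases le_total 0 (Real.log K) with hl | hl
  · rw [Real.sq_sqrt (by positivity), mul_div_cancel_left₀ _ two_ne_zero, Real.exp_neg,
      Real.exp_log hK0]
    calc (T : ℝ) * (N * (K⁻¹ / q)) = (T * N / q) / K := by ring
      _ ≤ 1 := (div_le_one hK0).2 hTN
  -- If `log K ≤ 0`, the truncated square root makes the exponential equal to `1`, and `K ≤ 1`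
  -- itself gives the bound.
  · rw [Real.sqrt_eq_zero_of_nonpos (by linarith)]
    have hK1 : K ≤ 1 := (Real.log_nonpos_iff hK0.le).1 hl
    calc (T : ℝ) * (N * (Real.exp (-(0 ^ 2 / 2)) / q)) = T * N / q := by
          simp
          ring
      _ ≤ 1 := hTN.trans hK1

end Regret

end GaussianBandit

/-! ### The Bayesian regret bound -/

theorem mainTheorem11 {Ω Θ 𝒜 : Type*} [MeasurableSpace Ω] [MeasurableSpace Θ]
    [Fintype 𝒜] [MeasurableSpace 𝒜] [MeasurableSingletonClass 𝒜]
    (μ : Measure Ω) [IsProbabilityMeasure μ]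
    (f : Θ → 𝒜 → ℝ) (θ : Ω → Θ)
    (S : ℕ → Ω → Set 𝒜) (A : ℕ → Ω → 𝒜) (R : ℕ → Ω → ℝ)
    (κ : (t : ℕ) → Kernel (GaussianBandit.Past 𝒜 t) (Set 𝒜)) [∀ t, IsMarkovKernel (κ t)]
    (π : (t : ℕ) → Kernel (GaussianBandit.Hist 𝒜 t) 𝒜) [∀ t, IsMarkovKernel (π t)]
    (hmodel : GaussianBandit.IsInteraction μ f θ S A R κ π)
    (hps : GaussianBandit.IsPosteriorSampling μ f θ S A R π)
    (hgauss : HasGaussianLaw (fun ω a => f (θ ω) a) μ)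
    (hvar : ∀ a, Var[fun ω => f (θ ω) a; μ] ≤ 1)
    (σ : ℝ) (hσ : 0 < σ)
    (hnoise : GaussianBandit.IsGaussianNoise μ f θ S A R σ)
    (T : ℕ) :
    (∀ t, Integrable (GaussianBandit.periodRegret f θ S A t) μ) ∧
    GaussianBandit.bayesRegret μ f θ S A T ≤
      1 + 2 * Real.sqrt (T * GaussianBandit.maxInfoGain (μ.map fun ω a => f (θ ω) a) σ T *
        (Real.log (1 + (σ ^ 2)⁻¹))⁻¹ *
        Real.log (((T : ℝ) ^ 2 + 1) * (Fintype.card 𝒜 : ℝ) / Real.sqrt (2 * Real.pi))) := by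
  set P := μ.map fun ω a => f (θ ω) a with hP_def
  have : IsGaussian P := hgauss.isGaussian_map
  have hP : HasLaw (fun ω a => f (θ ω) a) P μ := ⟨hgauss.aemeasurable, rfl⟩
  have hvarP (b : 𝒜) : Var[fun z => z b; P] ≤ 1 := by
    rw [hP_def, variance_map (measurable_pi_apply b).aemeasurable hgauss.aemeasurable]
    exact hvar b
  set K := ((T : ℝ) ^ 2 + 1) * (Fintype.card 𝒜 : ℝ) / Real.sqrt (2 * Real.pi) with hK
  set r := Real.sqrt (2 * Real.log K) with hr_def
  have hr : 0 ≤ r := Real.sqrt_nonneg _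
  have hreg := hmodel.integral_periodRegret_le hP hσ hnoise hps hvarP hr
  refine ⟨fun t => (hreg t).1, ?_⟩
  have : Nonempty Ω := nonempty_of_isProbabilityMeasure μ
  have hcard : 0 < Fintype.card 𝒜 := Fintype.card_pos_iff.2 ⟨A 0 (Classical.arbitrary Ω)⟩
  have hs (t : ℕ) := GaussianBandit.integrable_postStd hmodel (σ ^ 2).toNNReal
    (GaussianBandit.centeredLaw P) t
  have hsA (t : ℕ) := GaussianBandit.integrable_randomIndex (hs t) (hmodel.measurable_action t)
  set G := GaussianBandit.maxInfoGain P σ T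
  set L := (Real.log (1 + (σ ^ 2)⁻¹))⁻¹
  have hsum := integral_mono (integrable_finsetSum (Finset.range T) fun t _ => hsA t)
    (integrable_const _) (GaussianBandit.sum_postStd_le hσ hvarP A T)
  rw [integral_finsetSum _ fun t _ => hsA t, integral_const, probReal_univ, one_smul] at hsum
  calc GaussianBandit.bayesRegret μ f θ S A T
      ≤ ∑ t ∈ Finset.range T, (Fintype.card 𝒜 *
          (Real.exp (-(r ^ 2 / 2)) / Real.sqrt (2 * Real.pi)) +
          r * ∫ ω, GaussianBandit.postStd (σ ^ 2).toNNReal (GaussianBandit.centeredLaw P) t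
            (GaussianBandit.actionsUpTo A t ω) (A t ω) ∂μ) :=
        Finset.sum_le_sum fun t _ => (hreg t).2
    _ ≤ 1 + r * Real.sqrt (T * (2 * G * L)) := by
        rw [Finset.sum_add_distrib, Finset.sum_const, Finset.card_range, nsmul_eq_mul,
          ← Finset.mul_sum]
        exact add_le_add (GaussianBandit.card_mul_excess_le_one T hcard)
          (mul_le_mul_of_nonneg_left hsum hr)
    _ ≤ 1 + 2 * Real.sqrt (T * G * L * Real.log K) := by
        refine add_le_add_right ?_ 1
        -- For `log K ≤ 0` the left side vanishes because `r = 0`. Otherwise the two factors `2`,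
        -- one from `r` and one from the variance sum, combine to the `2` in front of the root.
        rcases le_total (Real.log K) 0 with hl | hl
        · rw [hr_def, Real.sqrt_eq_zero_of_nonpos (by linarith), zero_mul]
          positivity
        · rw [hr_def, ← Real.sqrt_mul (by positivity)]
          have h4 : 2 * Real.log K * (T * (2 * G * L)) = 2 ^ 2 * (T * G * L * Real.log K) := by
            ring
          rw [h4, Real.sqrt_mul (by positivity), Real.sqrt_sq (by norm_num)]
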